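/- **Setting.** A (cyclic) pattern of period $n$ is a cyclic permutation $\pi$ of $T_n=\{1,\dots,n\}$; a cycle $P$ of an interval map has pattern $\pi$ if the map acts on the points of $P$, numbered from left to right, as $\pi$. The over-rotation pair of a pattern $\pi$ of period $q\ge 2$ is $(p,q)$, where $2p$ is the number of $x$ for which $\pi(x)-x$ and $\pi^2(x)-\pi(x)$ have different signs, and $\rho(\pi)=p/q$ is its over-rotation number. A pattern is unimodal if it is strictly increasing up to some interior point and strictly decreasing from that point on. The pattern $\pi$ forces $\theta$ if every continuous interval map with a cycle of pattern $\pi$ has a cycle of pattern $\theta$. The over-rotation interval of an interval map is the closure of the set of over-rotation numbers of its cycles of period at least $2$; the over-rotation interval $I_\pi$ forced by $\pi$ is that of the $P$-linear map of a cycle $P$ of pattern $\pi$. An over-twist is a pattern of period at least $2$ that forces no other pattern of the same over-rotation number. A pattern $\pi$ has a block structure over $\theta$ if its points split into disjoint consecutive nonempty blocks (one-point blocks are allowed) that $\pi$ permutes as $\theta$. A pattern $\pi$ is very badly ordered if $\rho(\pi)$ is the left endpoint of $I_\pi$ and $\pi$ has no block structure over an over-twist of over-rotation number $\rho(\pi)$.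 **Construction.** Let $p,q,k$ be positive integers with $\gcd(p,q)=1$, $2p<q$ and $k>1$. Let $\gamma=\gamma_{p/q}$ be the unimodal pattern of period $q$ with $$\gamma(j)=\begin{cases} j+p, & 1\le j\le q-2p,\\ 2q-2p+1-j, & q-2p+1\le j\le q-p,\\ q+1-j, & q-p+1\le j\le q.\end{cases}$$ Take $k$ copies $P_1,\dots,P_k$ of $\gamma$ and write $x_{j,i}$ for the $j$-th point from the left of $P_i$. Order the $kq$ points on the line so that $x_{j,i}<x_{j',i'}$ whenever $j<j'$, and so that, for fixed $j$, $x_{j,1}<x_{j,2}<\dots<x_{j,k}$ if $j\le q-p$ and $x_{j,1}>x_{j,2}>\dots>x_{j,k}$ if $j>q-p$. Put $f(x_{j,i})=x_{\gamma(j),i}$ (the $k$-tuple lifting of $\gamma$). Define $g$ by $$g(x_{1,1})=x_{p,2},\qquad g(x_{q+1-p,i})=x_{p,i+1}\ (2\le i\le k-1),\qquad g(x_{q+1-p,k})=f(x_{1,1})=x_{p+1,1},$$ and $g=f$ at all other points. **Theorem.** For all such $p,q,k$, the map $g$ on these $kq$ points is a single cycle; its pattern is unimodal and has over-rotation pair $(kp,kq)$;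 the over-rotation interval forced by it is exactly $[p/q,1/2]$; and it has no block structure over any over-twist. In particular it is very badly ordered. Consequently, for any positive integers $r,s$ with $2r<s$ that are not coprime, there is a very badly ordered unimodal cyclic pattern with over-rotation pair $(r,s)$. -/

import Mathlib

/-!  # Patterns of cycles of interval maps and over-rotation numbers

A pattern of period `n` is a self-map `π` of `{0, …, n - 1}` (the points of the cycle, numbered
from left to right) that permutes all these points in a single cycle. -/

/-- `π` is a cyclic pattern: the orbit of every point is everything (so, `Fin n` being finite,
`π` is a cyclic permutation of `n` points). -/
def IsCyclicPattern {n : ℕ} (π : Fin n → Fin n) : Prop :=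
  ∀ i j, ∃ m : ℕ, π^[m] i = j

/-- The number of points `x` at which `π x - x` and `π (π x) - π x` have different signs. -/
def signChanges {n : ℕ} (π : Fin n → Fin n) : ℕ :=
  (Finset.univ.filter fun x : Fin n =>
    (x < π x ∧ π (π x) < π x) ∨ (π x < x ∧ π x < π (π x))).card

/-- `(p, q)` is the over-rotation pair of `π`: `q` is the period and `2 p` is the number of sign
changes. -/
def HasOverRotationPair {n : ℕ} (π : Fin n → Fin n) (p q : ℕ) : Prop :=
  n = q ∧ 2 * p = signChanges π

/-- The over-rotation number `p / q` of a pattern with over-rotation pair `(p, q)`. -/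
noncomputable def overRotationNumber {n : ℕ} (π : Fin n → Fin n) : ℝ :=
  (signChanges π : ℝ) / (2 * n)

/-- `f` restricts to a continuous map of the interval `[a, b]` into itself. -/
def IsIntervalMap (f : ℝ → ℝ) (a b : ℝ) : Prop :=
  ContinuousOn f (Set.Icc a b) ∧ Set.MapsTo f (Set.Icc a b) (Set.Icc a b)

/-- The map `f` of `[a, b]` has a cycle of pattern `π`. -/
def Exhibits (f : ℝ → ℝ) (a b : ℝ) {n : ℕ} (π : Fin n → Fin n) : Prop :=
  ∃ x : Fin n → ℝ, StrictMono x ∧ (∀ i, x i ∈ Set.Icc a b) ∧ ∀ i, f (x i) = x (π i)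

/-- `π` forces `θ`: every continuous interval map with a cycle of pattern `π` has a cycle of
pattern `θ`. -/
def Forces {n m : ℕ} (π : Fin n → Fin n) (θ : Fin m → Fin m) : Prop :=
  ∀ (f : ℝ → ℝ) (a b : ℝ), IsIntervalMap f a b → Exhibits f a b π → Exhibits f a b θ

/-- The over-rotation interval of a map `f` of `[a, b]`: the closure of the set of over-rotation
numbers of all its cycles of period at least two. -/
def overRotationInterval (f : ℝ → ℝ) (a b : ℝ) : Set ℝ :=
  closure {r | ∃ (n : ℕ) (π : Fin n → Fin n),
    2 ≤ n ∧ IsCyclicPattern π ∧ Exhibits f a b π ∧ r = overRotationNumber π}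

/-- The values of a pattern at natural numbers, as real numbers (zero outside `{0, …, n - 1}`). -/
noncomputable def patternValue {n : ℕ} (π : Fin n → Fin n) (i : ℕ) : ℝ :=
  if h : i < n then ((π ⟨i, h⟩ : ℕ) : ℝ) else 0

/-- The `P`-linear map of the cycle `P = {0, …, n - 1}` of pattern `π`: on the interval
`[0, n - 1]` it interpolates `π` linearly between consecutive points of `P`. -/
noncomputable def linearMap {n : ℕ} (π : Fin n → Fin n) (t : ℝ) : ℝ :=
  patternValue π ⌊t⌋₊ +
    (t - (⌊t⌋₊ : ℝ)) * (patternValue π (⌊t⌋₊ + 1) - patternValue π ⌊t⌋₊)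

theorem linearMap_natCast {n : ℕ} (π : Fin n → Fin n) (i : Fin n) :
    linearMap π ((i : ℕ) : ℝ) = ((π i : ℕ) : ℝ) := by
  simp [linearMap, patternValue]

/-- The over-rotation interval forced by a pattern: that of its `P`-linear map. -/
noncomputable def forcedInterval {n : ℕ} (π : Fin n → Fin n) : Set ℝ :=
  overRotationInterval (linearMap π) 0 ((n : ℝ) - 1)

/-- `π` is unimodal: strictly increasing up to an interior point `c`, strictly decreasing
from `c` on. -/
def IsUnimodalPattern {n : ℕ} (π : Fin n → Fin n) : Prop :=
  ∃ c : Fin n, (∃ i, i < c) ∧ (∃ j, c < j) ∧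
    StrictMonoOn π (Set.Iic c) ∧ StrictAntiOn π (Set.Ici c)

/-- An over-twist: a cyclic pattern of period at least two that is forcing-minimal among the
patterns of its over-rotation number, i.e. it forces no other pattern of that number. -/
def IsOverTwist {m : ℕ} (θ : Fin m → Fin m) : Prop :=
  2 ≤ m ∧ IsCyclicPattern θ ∧
    ∀ (n : ℕ) (π : Fin n → Fin n), 2 ≤ n → IsCyclicPattern π →
      overRotationNumber π = overRotationNumber θ → Forces θ π →
        (⟨n, π⟩ : Σ l : ℕ, (Fin l → Fin l)) = ⟨m, θ⟩

/-- `π` has a block structure over `θ`: the points of `π` are partitioned into disjoint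
consecutive blocks `I 0 < ⋯ < I (m - 1)`, and `π` maps the block `I j` onto the block `I (θ j)`.
Blocks consisting of one point are allowed. -/
def HasBlockStructureOver {n m : ℕ} (π : Fin n → Fin n) (θ : Fin m → Fin m) : Prop :=
  ∃ I : Fin m → Set (Fin n),
    (∀ j, (I j).Nonempty ∧ (I j).OrdConnected) ∧
    (⋃ j, I j) = Set.univ ∧
    (∀ i j, i < j → ∀ x ∈ I i, ∀ y ∈ I j, x < y) ∧
    ∀ j, π '' I j = I (θ j)

/-- A cyclic pattern is very badly ordered if its over-rotation number is the left endpoint of the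
forced over-rotation interval, while it has no block structure over an over-twist of the same
over-rotation number. -/
def IsVeryBadlyOrdered {n : ℕ} (π : Fin n → Fin n) : Prop :=
  2 ≤ n ∧ IsCyclicPattern π ∧
    IsLeast (forcedInterval π) (overRotationNumber π) ∧
    ∀ (m : ℕ) (θ : Fin m → Fin m), IsOverTwist θ →
      overRotationNumber θ = overRotationNumber π → ¬ HasBlockStructureOver π θ

/-- The unimodal over-twist pattern `γ_{p/q}`, points numbered from `0`: the first `q - 2p` points
are shifted by `p` to the right, the next `p` are flipped all the way to the right, the last `p`
are flipped all the way to the left. -/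
def gammaPattern (p q : ℕ) (h : 2 * p < q) (j : Fin q) : Fin q :=
  if h₁ : (j : ℕ) < q - 2 * p then ⟨j + p, by omega⟩
  else if h₂ : (j : ℕ) < q - p then ⟨2 * q - 2 * p - 1 - j, by omega⟩
  else ⟨q - 1 - j, by omega⟩

/-! The points of the `k` copies `P₁, …, P_k` of `γ_{p/q}` are labelled by pairs `(j, i)`: the
`j`-th point from the left of the copy `P_{i+1}`. -/

/-- Spatial position of the labelled points: the `k` points with the same `j` are adjacent, and
within such a group the points of `P₁, …, P_k` follow each other towards the fixed point, with
`P₁` the farthest from it. So the order is `P₁, …, P_k` from left to right when the group lies to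
the left of the fixed point (is moved to the right by `γ_{p/q}`), and the reverse otherwise. -/
def spatialPosition (p q k : ℕ) (h : 2 * p < q) : Fin q × Fin k ≃ Fin (q * k) :=
  (Equiv.prodShear (Equiv.refl (Fin q)) fun j =>
    if j < gammaPattern p q h j then Equiv.refl (Fin k) else Fin.revPerm).trans finProdFinEquiv

/-- The `k`-tuple lifting `f` of `γ_{p/q}`, on labels: every copy is a cycle of pattern
`γ_{p/q}`. -/
def liftingOnLabels (p q k : ℕ) (h : 2 * p < q) (x : Fin q × Fin k) : Fin q × Fin k :=
  (gammaPattern p q h x.1, x.2)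

/-- The glued map `g`, on labels. The leftmost point of `P₁` goes to the `p`-th point from the left
of `P₂`; for `i = 2, …, k`, the point of `P_i` that `f` sends to the `p`-th point of `P_i` goes to
the `p`-th point of `P_{i+1}` or, when `i = k`, to the `f`-image of the leftmost point of `P₁`.
Elsewhere `g = f`. -/
def gluedOnLabels (p q k : ℕ) (h : 2 * p < q) (hk : 1 < k) (x : Fin q × Fin k) :
    Fin q × Fin k :=
  if (x.1 : ℕ) = 0 ∧ (x.2 : ℕ) = 0 then (⟨p - 1, by omega⟩, ⟨1, hk⟩)
  else if (gammaPattern p q h x.1 : ℕ) = p - 1 ∧ 1 ≤ (x.2 : ℕ) then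
    if hx : (x.2 : ℕ) + 1 < k then (⟨p - 1, by omega⟩, ⟨x.2 + 1, hx⟩)
    else liftingOnLabels p q k h (⟨0, by omega⟩, ⟨0, by omega⟩)
  else liftingOnLabels p q k h x

/-- The pattern obtained by gluing `k` copies of `γ_{p/q}`: the glued map `g` with its `q * k`
points numbered from left to right. -/
def gluedPattern (p q k : ℕ) (h : 2 * p < q) (hk : 1 < k) : Fin (q * k) → Fin (q * k) :=
  fun n => spatialPosition p q k h
    (gluedOnLabels p q k h hk ((spatialPosition p q k h).symm n))

/-! ## Covering loops of intervals -/

/-! The linear map has a fixed point `a` such that points to its left move right and points to its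
right land on its left. So the over-rotation number of a cycle of period at least 2 is the fraction
of its points right of `a` (`signChanges_of_exhibited`).

The main tool is an integer code. For `γ` it changes by exactly `-p` at a left point and `q - p` at
a right one, and it is injective modulo `q`. The gluing keeps such a code alive
(`gluedCode_gluedValue`); its level sets are the groups of `k` neighbours displaced by one position,
so that the leftmost point is split off from the next `k`.

Lower bound: on each side the code does not decrease away from `a`. Extended to the interval through
the neighbour farther from `a`, it changes by at most `-p` or `q - p` under the linear map. Summing
over a cycle with `n` points, `R` of them on the right, gives `0 ≤ q R - p n`. The upper bound 1/2
holds for every pattern.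

Filling the interval: the pairs spanned by the first two copies cover one another as `γ` permutes
its points, because the gluing only pushes image end points outward. This is a loop of number `p/q`.
The two halves of the basic interval around `a` form a loop of length 2 and number 1/2. The central
loop covers a pair of the first loop. Conversely, the points 0 and 1 have different codes, and
orbits with different codes cannot stay on the same side forever (`exists_separating_iterate`), so
an image of their pair eventually spans `a`. Running both loops in arbitrary proportion gives a
dense set of numbers.

Block structures: the loop of pairs also shows that the glued pattern forces `γ`, so it is no
over-twist, which excludes one-point blocks. A larger block at the left end would contain the
turning point, which reaches position 0 in two steps; then `θ` would swap two blocks, yet the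
leftmost point moves right twice in a row. -/

theorem exists_subinterval_mapsTo_Icc {φ : ℝ → ℝ} {l h : ℝ} (hlh : l ≤ h)
    (hφ : ContinuousOn φ (Set.Icc l h)) (hle : φ l ≤ φ h) :
    ∃ u v, l ≤ u ∧ u ≤ v ∧ v ≤ h ∧ φ u = φ l ∧ φ v = φ h ∧
      ∀ x ∈ Set.Icc u v, φ x ∈ Set.Icc (φ l) (φ h) := by
  -- The first point with value `φ h`, and then the last point before it with value `φ l`: between
  -- them an overshoot would produce an earlier or later such point.
  obtain ⟨v, ⟨hvm, hv⟩, hvmin⟩ : ∃ v, IsLeast (Set.Icc l h ∩ φ ⁻¹' {φ h}) v :=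
    (isCompact_Icc.of_isClosed_subset
      (hφ.preimage_isClosed_of_isClosed isClosed_Icc isClosed_singleton)
      Set.inter_subset_left).exists_isLeast ⟨h, ⟨hlh, le_rfl⟩, rfl⟩
  have hφv : ContinuousOn φ (Set.Icc l v) := hφ.mono (Set.Icc_subset_Icc_right hvm.2)
  obtain ⟨u, ⟨hum, hu⟩, humax⟩ : ∃ u, IsGreatest (Set.Icc l v ∩ φ ⁻¹' {φ l}) u :=
    (isCompact_Icc.of_isClosed_subset
      (hφv.preimage_isClosed_of_isClosed isClosed_Icc isClosed_singleton)
      Set.inter_subset_left).exists_isGreatest ⟨l, ⟨le_rfl, hvm.1⟩, rfl⟩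
  simp only [Set.mem_preimage, Set.mem_singleton_iff] at hv hu
  refine ⟨u, v, hum.1, hum.2, hvm.2, hu, hv, fun x hx => ⟨?_, ?_⟩⟩
  · by_contra! hlt
    obtain ⟨y, hy, hy'⟩ := intermediate_value_Icc hx.2
      (hφv.mono (Set.Icc_subset_Icc_left (hum.1.trans hx.1)))
      (show φ l ∈ Set.Icc (φ x) (φ v) from ⟨hlt.le, hv ▸ hle⟩)
    have := humax ⟨⟨(hum.1.trans hx.1).trans hy.1, hy.2⟩, hy'⟩
    have hxy : x = y := le_antisymm hy.1 (this.trans hx.1)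
    rw [hxy] at hlt
    exact hlt.ne hy'
  · by_contra! hlt
    obtain ⟨y, hy, hy'⟩ := intermediate_value_Icc (hum.1.trans hx.1)
      (hφv.mono (Set.Icc_subset_Icc_right hx.2))
      (show φ h ∈ Set.Icc (φ l) (φ x) from ⟨hle, hlt.le⟩)
    have := hvmin ⟨⟨hy.1, hy.2.trans (hx.2.trans hvm.2)⟩, hy'⟩
    have hxy : x = y := le_antisymm (hx.2.trans this) hy.2
    rw [hxy] at hlt
    exact hlt.ne' hy'

theorem exists_subinterval_mapsTo_uIcc_of_le {φ : ℝ → ℝ} {l h : ℝ} (hlh : l ≤ h)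
    (hφ : ContinuousOn φ (Set.Icc l h)) :
    ∃ u ∈ Set.Icc l h, ∃ v ∈ Set.Icc l h, φ u = φ l ∧ φ v = φ h ∧
      ∀ x ∈ Set.uIcc u v, φ x ∈ Set.uIcc (φ l) (φ h) := by
  rcases le_total (φ l) (φ h) with hle | hle
  · obtain ⟨u, v, h1, h2, h3, h4, h5, h6⟩ := exists_subinterval_mapsTo_Icc hlh hφ hle
    refine ⟨u, ⟨h1, h2.trans h3⟩, v, ⟨h1.trans h2, h3⟩, h4, h5, ?_⟩
    rwa [Set.uIcc_of_le h2, Set.uIcc_of_le hle]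
  · obtain ⟨u, v, h1, h2, h3, h4, h5, h6⟩ :=
      exists_subinterval_mapsTo_Icc hlh hφ.neg (by simpa using hle)
    refine ⟨u, ⟨h1, h2.trans h3⟩, v, ⟨h1.trans h2, h3⟩, neg_injective h4, neg_injective h5, ?_⟩
    rw [Set.uIcc_of_le h2, Set.uIcc_of_ge hle]
    intro x hx
    have := h6 x hx
    simp only [Pi.neg_apply, Set.mem_Icc, neg_le_neg_iff] at this
    exact ⟨this.2, this.1⟩

theorem exists_subinterval_mapsTo_uIcc {φ : ℝ → ℝ} {l h c d : ℝ}
    (hφ : ContinuousOn φ (Set.uIcc l h)) (hc : c ∈ Set.uIcc (φ l) (φ h))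
    (hd : d ∈ Set.uIcc (φ l) (φ h)) :
    ∃ u ∈ Set.uIcc l h, ∃ v ∈ Set.uIcc l h, φ u = c ∧ φ v = d ∧
      ∀ x ∈ Set.uIcc u v, φ x ∈ Set.uIcc c d := by
  obtain ⟨u₀, hu₀, rfl⟩ := intermediate_value_uIcc hφ hc
  obtain ⟨v₀, hv₀, rfl⟩ := intermediate_value_uIcc hφ hd
  have hsub : Set.uIcc u₀ v₀ ⊆ Set.uIcc l h := Set.uIcc_subset_uIcc hu₀ hv₀
  rcases le_total u₀ v₀ with hle | hle
  · rw [Set.uIcc_of_le hle] at hsub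
    obtain ⟨u, hu, v, hv, h1, h2, h3⟩ :=
      exists_subinterval_mapsTo_uIcc_of_le hle (hφ.mono hsub)
    exact ⟨u, hsub hu, v, hsub hv, h1, h2, h3⟩
  · rw [Set.uIcc_of_ge hle] at hsub
    obtain ⟨u, hu, v, hv, h1, h2, h3⟩ :=
      exists_subinterval_mapsTo_uIcc_of_le hle (hφ.mono hsub)
    refine ⟨v, hsub hv, u, hsub hu, h2, h1, ?_⟩
    rwa [Set.uIcc_comm v, Set.uIcc_comm (φ u₀)]

/-- The interval spanned by the pair `I` is mapped by `f` over the one spanned by `J`, already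
in view of the images of its end points. -/
def Covers (f : ℝ → ℝ) (I J : ℝ × ℝ) : Prop :=
  Set.uIcc J.1 J.2 ⊆ Set.uIcc (f I.1) (f I.2)

theorem exists_subinterval_of_covers {f : ℝ → ℝ} {s : Set ℝ} (hf : ContinuousOn f s) (n : ℕ) :
    ∀ J : ℕ → ℝ × ℝ, (∀ i ≤ n, Set.uIcc (J i).1 (J i).2 ⊆ s) →
      (∀ i < n, Covers f (J i) (J (i + 1))) →
      ∃ u ∈ Set.uIcc (J 0).1 (J 0).2, ∃ v ∈ Set.uIcc (J 0).1 (J 0).2,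
        f^[n] u = (J n).1 ∧ f^[n] v = (J n).2 ∧
        ∀ x ∈ Set.uIcc u v, ∀ i ≤ n, f^[i] x ∈ Set.uIcc (J i).1 (J i).2 := by
  induction n with
  | zero =>
    intro J _ _
    refine ⟨_, Set.left_mem_uIcc, _, Set.right_mem_uIcc, rfl, rfl, fun x hx i hi => ?_⟩
    obtain rfl : i = 0 := by omega
    exact hx
  | succ n ih =>
    intro J hJs hJ
    obtain ⟨u', hu', v', hv', h1, h2, h3⟩ := ih (fun i => J (i + 1))
      (fun i hi => hJs _ (by omega)) (fun i hi => hJ _ (by omega))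
    have h0 := hJ 0 (by omega)
    obtain ⟨u, hu, v, hv, h4, h5, h6⟩ :=
      exists_subinterval_mapsTo_uIcc (hf.mono (hJs 0 (by omega))) (h0 hu') (h0 hv')
    refine ⟨u, hu, v, hv, by rw [Function.iterate_succ_apply, h4, h1],
      by rw [Function.iterate_succ_apply, h5, h2], fun x hx i hi => ?_⟩
    cases i with
    | zero => exact Set.uIcc_subset_uIcc hu hv hx
    | succ i => exact h3 _ (h6 x hx) i (by omega)

theorem IsIntervalMap.continuousOn_iterate {f : ℝ → ℝ} {a b : ℝ} (hf : IsIntervalMap f a b)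
    (n : ℕ) : ContinuousOn f^[n] (Set.Icc a b) := hf.1.iterate hf.2 n

theorem exists_periodic_of_covers {f : ℝ → ℝ} {a b : ℝ} (hf : IsIntervalMap f a b) (n : ℕ)
    (J : ℕ → ℝ × ℝ) (hJs : ∀ i ≤ n, Set.uIcc (J i).1 (J i).2 ⊆ Set.Icc a b)
    (hJ : ∀ i < n, Covers f (J i) (J (i + 1))) (hn : J n = J 0) :
    ∃ x, f^[n] x = x ∧ ∀ i ≤ n, f^[i] x ∈ Set.uIcc (J i).1 (J i).2 := by
  obtain ⟨u, hu, v, hv, h1, h2, h3⟩ := exists_subinterval_of_covers hf.1 n J hJs hJ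
  have hsub : Set.uIcc u v ⊆ Set.Icc a b :=
    (Set.uIcc_subset_uIcc hu hv).trans (hJs 0 (by omega))
  have hc : ContinuousOn (fun x => f^[n] x - x) (Set.uIcc u v) :=
    ((hf.continuousOn_iterate n).mono hsub).sub continuousOn_id
  rw [hn] at h1 h2
  -- The points `u` and `v` go to the two ends of `J 0`, and both lie in `J 0`, so `f^[n] x - x`
  -- changes sign between them.
  have h0 : (0 : ℝ) ∈ Set.uIcc (f^[n] u - u) (f^[n] v - v) := by
    rw [h1, h2]
    rw [Set.mem_uIcc] at hu hv ⊢
    rcases hu with hu | hu <;> rcases hv with hv | hv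
    · exact Or.inl ⟨by linarith, by linarith⟩
    · exact Or.inl ⟨by linarith, by linarith⟩
    · exact Or.inl ⟨by linarith, by linarith⟩
    · exact Or.inr ⟨by linarith, by linarith⟩
  obtain ⟨x, hx, hx'⟩ := intermediate_value_uIcc hc h0
  exact ⟨x, sub_eq_zero.1 hx', h3 x hx⟩

/-- There is a path of `n` coverings from `I` to `J` through intervals of `[lo, hi]` on one side of
`a` each, of which (not counting `J`) exactly `r` lie to the right of `a`. -/
inductive CoverPath (f : ℝ → ℝ) (lo hi a : ℝ) : ℝ × ℝ → ℝ × ℝ → ℕ → ℕ → Prop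
  | refl (I : ℝ × ℝ) (hI : Set.uIcc I.1 I.2 ⊆ Set.Icc lo hi) : CoverPath f lo hi a I I 0 0
  | left {I J K : ℝ × ℝ} {n r : ℕ} (hI : Set.uIcc I.1 I.2 ⊆ Set.Icc lo a) (ha : a ≤ hi)
      (hIJ : Covers f I J) (hJK : CoverPath f lo hi a J K n r) : CoverPath f lo hi a I K (n + 1) r
  | right {I J K : ℝ × ℝ} {n r : ℕ} (hI : Set.uIcc I.1 I.2 ⊆ Set.Icc a hi) (ha : lo ≤ a)
      (hIJ : Covers f I J) (hJK : CoverPath f lo hi a J K n r) :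
      CoverPath f lo hi a I K (n + 1) (r + 1)

namespace CoverPath

variable {f : ℝ → ℝ} {lo hi a : ℝ} {I J K : ℝ × ℝ} {n m r s : ℕ}

theorem trans (h₁ : CoverPath f lo hi a I J n r) (h₂ : CoverPath f lo hi a J K m s) :
    CoverPath f lo hi a I K (n + m) (r + s) := by
  induction h₁ with
  | refl => simpa using h₂
  | left hI ha hIJ _ ih => rw [Nat.add_right_comm]; exact left hI ha hIJ (ih h₂)
  | right hI ha hIJ _ ih =>
    rw [Nat.add_right_comm, Nat.add_right_comm _ 1]; exact right hI ha hIJ (ih h₂)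

theorem subset_Icc (h : CoverPath f lo hi a I J n r) : Set.uIcc I.1 I.2 ⊆ Set.Icc lo hi := by
  cases h with
  | refl _ hI => exact hI
  | left hI ha => exact hI.trans (Set.Icc_subset_Icc_right ha)
  | right hI ha => exact hI.trans (Set.Icc_subset_Icc_left ha)

theorem pow (h : CoverPath f lo hi a I I n r) (m : ℕ) :
    CoverPath f lo hi a I I (m * n) (m * r) := by
  induction m with
  | zero => simpa using CoverPath.refl I h.subset_Icc
  | succ m ih => simpa [Nat.succ_mul] using ih.trans h

theorem exists_sequence (h : CoverPath f lo hi a I K n r) :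
    ∃ (J : ℕ → ℝ × ℝ) (c : ℕ → ℕ), J 0 = I ∧ J n = K ∧
      (∀ i ≤ n, Set.uIcc (J i).1 (J i).2 ⊆ Set.Icc lo hi) ∧
      (∀ i < n, Covers f (J i) (J (i + 1))) ∧
      (∀ i < n, Set.uIcc (J i).1 (J i).2 ⊆ Set.Iic a ∧ c i = 0 ∨
        Set.uIcc (J i).1 (J i).2 ⊆ Set.Ici a ∧ c i = 1) ∧
      ∑ i ∈ Finset.range n, c i = r := by
  induction h with
  | refl I hI =>
    exact ⟨fun _ => I, fun _ => 0, rfl, rfl, fun _ _ => hI, by simp, by simp, by simp⟩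
  | @left I J K n r hI ha hIJ h ih =>
    obtain ⟨S, c, h0, hn, hs, hc, hside, hsum⟩ := ih
    refine ⟨fun i => Nat.casesOn i I S, fun i => Nat.casesOn i 0 c, rfl, hn, ?_, ?_, ?_, ?_⟩
    · rintro (_ | i) hi
      · exact hI.trans (Set.Icc_subset_Icc_right ha)
      · exact hs i (by omega)
    · rintro (_ | i) hi
      · simpa [h0] using hIJ
      · exact hc i (by omega)
    · rintro (_ | i) hi
      · exact Or.inl ⟨hI.trans Set.Icc_subset_Iic_self, rfl⟩
      · exact hside i (by omega)
    · rw [Finset.sum_range_succ']; simpa using hsum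
  | @right I J K n r hI ha hIJ h ih =>
    obtain ⟨S, c, h0, hn, hs, hc, hside, hsum⟩ := ih
    refine ⟨fun i => Nat.casesOn i I S, fun i => Nat.casesOn i 1 c, rfl, hn, ?_, ?_, ?_, ?_⟩
    · rintro (_ | i) hi
      · exact hI.trans (Set.Icc_subset_Icc_left ha)
      · exact hs i (by omega)
    · rintro (_ | i) hi
      · simpa [h0] using hIJ
      · exact hc i (by omega)
    · rintro (_ | i) hi
      · exact Or.inr ⟨hI.trans Set.Icc_subset_Ici_self, rfl⟩
      · exact hside i (by omega)
    · rw [Finset.sum_range_succ']; simpa using hsum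

/-- The intervals of the path may have `a` as an end point, which would make the side of an orbit
point ambiguous. One interval avoiding `a` suffices: an orbit reaching `a` stays there and could not
return to `x`. -/
theorem exists_periodic (hf : IsIntervalMap f lo hi) (hfix : f a = a)
    (h : CoverPath f lo hi a I I n r) (haI : a ∉ Set.uIcc I.1 I.2) :
    ∃ x ∈ Set.Icc lo hi, f^[n] x = x ∧ x ≠ a ∧
      ((Finset.range n).filter fun i => a < f^[i] x).card = r := by
  obtain ⟨J, c, h0, hn, hs, hc, hside, hsum⟩ := h.exists_sequence
  obtain ⟨x, hx, hxJ⟩ := exists_periodic_of_covers hf n J hs hc (hn.trans h0.symm)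
  have hx0 : x ∈ Set.uIcc I.1 I.2 := h0 ▸ hxJ 0 (by omega)
  have hxa : x ≠ a := fun hxa => haI (hxa ▸ hx0)
  have hne : ∀ i ≤ n, f^[i] x ≠ a := by
    intro i hi hia
    apply hxa
    rw [← hx, ← Nat.sub_add_cancel hi, Function.iterate_add_apply, hia,
      Function.iterate_fixed hfix]
  refine ⟨x, h.subset_Icc hx0, hx, hxa, ?_⟩
  rw [← hsum, Finset.card_filter]
  refine Finset.sum_congr rfl fun i hi => ?_
  rw [Finset.mem_range] at hi
  rcases hside i hi with ⟨h1, h2⟩ | ⟨h1, h2⟩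
  · rw [h2, if_neg (not_lt.2 (h1 (hxJ i hi.le)))]
  · rw [h2, if_pos (lt_of_le_of_ne (h1 (hxJ i hi.le)) (hne i hi.le).symm)]

end CoverPath

/-! ## Patterns and their over-rotation numbers -/

theorem IsCyclicPattern.surjective {n : ℕ} {π : Fin n → Fin n} (hπ : IsCyclicPattern π) :
    Function.Surjective π := by
  intro j
  obtain ⟨m, hm⟩ := hπ (π j) j
  exact ⟨π^[m] j, by rwa [← Function.iterate_succ_apply' π, Function.iterate_succ_apply]⟩

theorem IsCyclicPattern.bijective {n : ℕ} {π : Fin n → Fin n} (hπ : IsCyclicPattern π) :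
    Function.Bijective π := Function.Surjective.bijective_of_finite hπ.surjective

theorem IsCyclicPattern.apply_ne {n : ℕ} {π : Fin n → Fin n} (hπ : IsCyclicPattern π)
    (hn : 2 ≤ n) (i : Fin n) : π i ≠ i := by
  intro hi
  have : Nontrivial (Fin n) := Fin.nontrivial_iff_two_le.2 hn
  obtain ⟨j, hj⟩ := exists_ne i
  obtain ⟨m, hm⟩ := hπ i j
  exact hj (hm ▸ Function.iterate_fixed hi m)

/-- Every visit to `R` lasts one step, so the sign changes are the entrances to `R` and the exits
from it. By bijectivity there are as many entrances as points of `R`. -/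
theorem signChanges_eq_two_mul {n : ℕ} {π : Fin n → Fin n} (hπ : Function.Bijective π)
    (R : Fin n → Prop) [DecidablePred R] (hl : ∀ i, ¬ R i → i < π i)
    (hr : ∀ i, R i → π i < i ∧ ¬ R (π i)) :
    signChanges π = 2 * (Finset.univ.filter R).card := by
  have h1 : (Finset.univ.filter fun i => R (π i)).card = (Finset.univ.filter R).card :=
    Finset.card_bijective π hπ (by simp)
  have h2 : (Finset.univ.filter fun x : Fin n =>
      (x < π x ∧ π (π x) < π x) ∨ (π x < x ∧ π x < π (π x))) =
      (Finset.univ.filter fun i => R (π i)) ∪ Finset.univ.filter R := by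
    ext x
    simp only [Finset.mem_filter, Finset.mem_univ, true_and, Finset.mem_union]
    by_cases hx : R x
    · have := hr x hx
      simp only [hx, or_true, iff_true]
      exact Or.inr ⟨this.1, hl _ this.2⟩
    · have hx' := hl x hx
      by_cases hx2 : R (π x)
      · simp [hx2, hx', (hr _ hx2).1]
      · simp [hx, hx2, hx'.not_gt, (hl _ hx2).not_gt]
  rw [signChanges, h2, Finset.card_union_of_disjoint, h1, two_mul]
  rw [Finset.disjoint_filter]
  exact fun i _ h h' => (hr i h').2 h

theorem overRotationNumber_le_half {n : ℕ} (π : Fin n → Fin n) : overRotationNumber π ≤ 1 / 2 := by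
  have h : signChanges π ≤ n := (Finset.card_le_univ _).trans (by simp)
  rw [overRotationNumber]
  rcases Nat.eq_zero_or_pos n with rfl | hn
  · simp
  · rw [div_le_div_iff₀ (by positivity) (by norm_num)]
    have : (signChanges π : ℝ) ≤ n := by exact_mod_cast h
    linarith

theorem IsCyclicPattern.exhibited_ne_fixedPoint {f : ℝ → ℝ} {a : ℝ} (hfix : f a = a) {n : ℕ}
    {π : Fin n → Fin n} (hn : 2 ≤ n) (hπ : IsCyclicPattern π) {x : Fin n → ℝ} (hx : StrictMono x)
    (hfx : ∀ i, f (x i) = x (π i)) (i : Fin n) : x i ≠ a := by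
  intro hi
  have : x (π i) = x i := by rw [← hfx, hi, hfix]
  exact hπ.apply_ne hn i (hx.injective this)

theorem signChanges_of_exhibited {f : ℝ → ℝ} {lo hi a : ℝ}
    (hl : ∀ t ∈ Set.Icc lo hi, t < a → t < f t)
    (hr : ∀ t ∈ Set.Icc lo hi, a < t → f t < a) (hfix : f a = a) {n : ℕ} {π : Fin n → Fin n}
    (hn : 2 ≤ n) (hπ : IsCyclicPattern π) {x : Fin n → ℝ} (hx : StrictMono x)
    (hxm : ∀ i, x i ∈ Set.Icc lo hi) (hfx : ∀ i, f (x i) = x (π i)) :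
    signChanges π = 2 * (Finset.univ.filter fun i => a < x i).card := by
  have hne := hπ.exhibited_ne_fixedPoint hfix hn hx hfx
  refine signChanges_eq_two_mul hπ.bijective _ (fun i hi => ?_) (fun i hi => ?_)
  · rw [← hx.lt_iff_lt, ← hfx]
    exact hl _ (hxm i) (lt_of_le_of_ne (not_lt.1 hi) (hne i))
  · have := hr _ (hxm i) hi
    rw [hfx] at this
    exact ⟨hx.lt_iff_lt.1 (this.trans hi), this.not_gt⟩

/-- Here `n` need not be the least period: going round the orbit several times does not change the
fraction of points on the right. The pattern is read off by numbering the orbit in increasing order.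
-/
theorem exists_pattern_of_periodic {f : ℝ → ℝ} {lo hi a : ℝ} (hf : IsIntervalMap f lo hi)
    (hl : ∀ t ∈ Set.Icc lo hi, t < a → t < f t)
    (hr : ∀ t ∈ Set.Icc lo hi, a < t → f t < a) (hfix : f a = a) {z : ℝ} {n : ℕ} (hn : 0 < n)
    (hz : z ∈ Set.Icc lo hi) (hza : z ≠ a) (hper : f^[n] z = z) :
    (((Finset.range n).filter fun i => a < f^[i] z).card : ℝ) / n ∈
      overRotationInterval f lo hi := by
  apply subset_closure
  have hp : Function.IsPeriodicPt f n z := hper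
  set M := Function.minimalPeriod f z with hM
  have hM0 : 0 < M := hp.minimalPeriod_pos hn
  have hMper : f^[M] z = z := Function.isPeriodicPt_minimalPeriod f z
  obtain ⟨c, rfl⟩ : M ∣ n := hp.minimalPeriod_dvd
  have hfz : f z ≠ z := by
    rcases lt_or_gt_of_ne hza with h | h
    · exact (hl z hz h).ne'
    · exact ((hr z hz h).trans h).ne
  have hM2 : 2 ≤ M := by
    by_contra h
    have : M = 1 := by omega
    rw [this] at hMper
    exact hfz hMper
  have hinj : Set.InjOn (fun i => f^[i] z) (Finset.range M) := by
    intro i hi j hj hij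
    simp only [Finset.coe_range, Set.mem_Iio] at hi hj
    exact (Function.iterate_eq_iterate_iff_of_lt_minimalPeriod hi hj).1 hij
  set S : Finset ℝ := (Finset.range M).image fun i => f^[i] z with hS
  have hcard : S.card = M := by rw [hS, Finset.card_image_of_injOn hinj, Finset.card_range]
  have hSiter : ∀ i, f^[i] z ∈ S := by
    intro i
    rw [← Function.iterate_mod_minimalPeriod_eq]
    exact Finset.mem_image_of_mem _ (Finset.mem_range.2 (Nat.mod_lt _ hM0))
  have hSf : ∀ t ∈ S, f t ∈ S := by
    intro t ht
    obtain ⟨i, _, rfl⟩ := Finset.mem_image.1 ht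
    rw [← Function.iterate_succ_apply' f]
    exact hSiter _
  set x := S.orderEmbOfFin hcard with hxdef
  have hxS : ∀ i, x i ∈ S := fun i => Finset.orderEmbOfFin_mem S hcard i
  have hsurj : ∀ t ∈ S, ∃ i, x i = t := by
    intro t ht
    have : t ∈ Set.range x := by rw [hxdef, Finset.range_orderEmbOfFin]; exact ht
    exact this
  choose π hπ using fun i => hsurj _ (hSf _ (hxS i))
  have hiter : ∀ m i, x (π^[m] i) = f^[m] (x i) := by
    intro m
    induction m with
    | zero => intro i; rfl
    | succ m ih => intro i; rw [Function.iterate_succ_apply', hπ, ih, Function.iterate_succ_apply']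
  have hcyc : IsCyclicPattern π := by
    intro i j
    obtain ⟨s, hs, hsi⟩ := Finset.mem_image.1 (hxS i)
    obtain ⟨t, ht, htj⟩ := Finset.mem_image.1 (hxS j)
    rw [Finset.mem_range] at hs ht
    -- Complete the turn from time `s` to time `M`, then advance by `t`.
    refine ⟨t + (M - s), x.injective ?_⟩
    rw [hiter, ← hsi, ← htj, ← Function.iterate_add_apply,
      show t + (M - s) + s = t + M by omega, Function.iterate_add_apply, hMper]
  have hxm : ∀ i, x i ∈ Set.Icc lo hi := by
    intro i
    obtain ⟨s, hs, hsi⟩ := Finset.mem_image.1 (hxS i)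
    rw [← hsi]
    exact hf.2.iterate s hz
  have hsc := signChanges_of_exhibited hl hr hfix hM2 hcyc x.strictMono hxm (fun i => (hπ i).symm)
  have hcount : (Finset.univ.filter fun i => a < x i).card =
      ((Finset.range M).filter fun i => a < f^[i] z).card := by
    have h1 : ((Finset.univ.filter fun i => a < x i).image x) =
        ((Finset.range M).filter fun i => a < f^[i] z).image fun i => f^[i] z := by
      ext t
      simp only [Finset.mem_image, Finset.mem_filter, Finset.mem_univ, true_and]
      constructor
      · rintro ⟨i, hi, rfl⟩
        obtain ⟨s, hs, hsi⟩ := Finset.mem_image.1 (hxS i)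
        exact ⟨s, ⟨hs, by simpa [hsi] using hi⟩, hsi⟩
      · rintro ⟨i, hi, rfl⟩
        obtain ⟨j, hj⟩ := hsurj _ (hSiter i)
        exact ⟨j, hj ▸ hi.2, hj⟩
    have h2 := congrArg Finset.card h1
    rwa [Finset.card_image_of_injective _ x.injective, Finset.card_image_of_injOn
      (hinj.mono (Finset.coe_subset.2 (Finset.filter_subset _ _)))] at h2
  have hmul : ((Finset.range (M * c)).filter fun i => a < f^[i] z).card =
      c * ((Finset.range M).filter fun i => a < f^[i] z).card := by
    simp only [Finset.card_filter]
    clear hn hper hp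
    induction c with
    | zero => simp
    | succ c ih =>
      rw [Nat.mul_succ, Finset.sum_range_add, ih, Nat.succ_mul]
      congr 1
      refine Finset.sum_congr rfl fun i _ => ?_
      rw [Nat.add_comm, Function.iterate_add_apply, Function.iterate_mul,
        Function.iterate_fixed hMper]
  refine ⟨M, π, hM2, hcyc, ⟨x, x.strictMono, hxm, fun i => (hπ i).symm⟩, ?_⟩
  have hc0 : 0 < c := Nat.pos_of_mul_pos_left hn
  rw [overRotationNumber, hsc, hcount, hmul]
  push_cast
  have : (M : ℝ) ≠ 0 := by positivity
  have : (c : ℝ) ≠ 0 := by positivity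
  field_simp

/-! ## The pattern `γ` -/

theorem gammaPattern_val (p q : ℕ) (h : 2 * p < q) (j : Fin q) :
    (gammaPattern p q h j : ℕ) = if (j : ℕ) < q - 2 * p then (j : ℕ) + p
      else if (j : ℕ) < q - p then 2 * q - 2 * p - 1 - j else q - 1 - j := by
  unfold gammaPattern
  split_ifs <;> rfl

theorem lt_gammaPattern_iff {p q : ℕ} (hp : 0 < p) (h : 2 * p < q) (j : Fin q) :
    j < gammaPattern p q h j ↔ (j : ℕ) + p < q := by
  rw [Fin.lt_def, gammaPattern_val]
  have := j.2
  split_ifs <;> omega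

theorem gammaPattern_val_eq_pred_iff {p q : ℕ} (hp : 0 < p) (h : 2 * p < q) (j : Fin q) :
    (gammaPattern p q h j : ℕ) = p - 1 ↔ (j : ℕ) + p = q := by
  rw [gammaPattern_val]
  have := j.2
  split_ifs <;> omega

/-- The code of `γ`: it changes by `-p` on moves from the left of the fixed point and by `q - p`
on moves from the right. -/
def gammaCode (p q j : ℕ) : ℤ := if j + p < q then -(j : ℤ) else (j : ℤ) + 1 + p - 2 * q

theorem gammaCode_gammaPattern {p q : ℕ} (h : 2 * p < q) (j : Fin q) :
    gammaCode p q (gammaPattern p q h j) =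
      gammaCode p q j - p + (if (j : ℕ) + p < q then 0 else (q : ℤ)) := by
  rw [gammaPattern_val]
  have := j.2
  unfold gammaCode
  split_ifs <;> omega

/-- Modulo `q` the code drops by `p` at every step, and `p` is invertible, so every residue is
reached. The residue determines the point. -/
theorem gammaPattern_isCyclicPattern {p q : ℕ} (hpq : Nat.Coprime p q) (h : 2 * p < q) :
    IsCyclicPattern (gammaPattern p q h) := by
  intro i j
  have hiter : ∀ m : ℕ, ((gammaCode p q ((gammaPattern p q h)^[m] i) : ℤ) : ZMod q) =
      gammaCode p q i - m * p := by
    intro m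
    induction m with
    | zero => simp
    | succ m ih =>
      rw [Function.iterate_succ_apply', gammaCode_gammaPattern]
      push_cast
      rw [ih]
      split_ifs <;> simp <;> ring
  have : NeZero q := ⟨by omega⟩
  refine ⟨((gammaCode p q i - gammaCode p q j : ZMod q) * (p : ZMod q)⁻¹).val, ?_⟩
  set m := ((gammaCode p q i - gammaCode p q j : ZMod q) * (p : ZMod q)⁻¹).val with hm
  have h1 := hiter m
  have h2 : (m : ZMod q) * p = gammaCode p q i - gammaCode p q j := by
    rw [hm, ZMod.natCast_val, ZMod.cast_id', id, mul_assoc, mul_comm (_⁻¹),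
      ZMod.coe_mul_inv_eq_one p hpq, mul_one]
  rw [h2, sub_sub_cancel, ZMod.intCast_eq_intCast_iff_dvd_sub] at h1
  set l := (gammaPattern p q h)^[m] i
  have hl := l.2
  have hj := j.2
  obtain ⟨c, hc⟩ := h1
  -- All codes lie in a window of `q` consecutive integers, so congruent codes are equal.
  have hb : ∀ t : Fin q, -(q : ℤ) < gammaCode p q t ∧ gammaCode p q t ≤ 0 := by
    intro t
    have := t.2
    unfold gammaCode
    split_ifs <;> omega
  have b1 := hb l
  have b2 := hb j
  have hc0 : c = 0 := by
    have h3 : (q : ℤ) * c < q * 1 := by omega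
    have h4 : (q : ℤ) * (-1) < q * c := by omega
    have h5 := lt_of_mul_lt_mul_left h3 (by omega)
    have h6 := lt_of_mul_lt_mul_left h4 (by omega)
    omega
  rw [hc0, mul_zero] at hc
  unfold gammaCode at hc
  ext
  split_ifs at hc <;> omega

theorem card_filter_le_add {N A : ℕ} (hA : 0 < A) (hAN : A ≤ N) :
    (Finset.univ.filter fun i : Fin N => N ≤ (i : ℕ) + A).card = A := by
  have : (Finset.univ.filter fun i : Fin N => N ≤ (i : ℕ) + A) =
      Finset.Ici (⟨N - A, by omega⟩ : Fin N) := by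
    ext i
    simp only [Finset.mem_filter, Finset.mem_univ, true_and, Finset.mem_Ici, Fin.le_def]
    omega
  rw [this, Fin.card_Ici]
  simp only
  omega

theorem signChanges_gammaPattern {p q : ℕ} (hp : 0 < p) (hpq : Nat.Coprime p q)
    (h : 2 * p < q) : signChanges (gammaPattern p q h) = 2 * p := by
  rw [signChanges_eq_two_mul (gammaPattern_isCyclicPattern hpq h).bijective
    (fun j => q ≤ (j : ℕ) + p)]
  · rw [card_filter_le_add hp (by omega)]
  · intro i hi
    rw [lt_gammaPattern_iff hp]
    omega
  · intro i hi
    rw [Fin.lt_def, gammaPattern_val]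
    have := i.2
    split_ifs <;> omega

theorem overRotationNumber_gammaPattern {p q : ℕ} (hp : 0 < p) (hpq : Nat.Coprime p q)
    (h : 2 * p < q) : overRotationNumber (gammaPattern p q h) = (p : ℝ) / q := by
  rw [overRotationNumber, signChanges_gammaPattern hp hpq]
  push_cast
  rw [mul_div_mul_left _ _ two_ne_zero]

/-! ## The glued pattern in spatial coordinates -/

/-- The glued pattern as a map of positions, with `A = p * k` and `N = q * k`. -/
def gluedValue (A N k n : ℕ) : ℕ :=
  if n = 0 then A + 1 - k
  else if n + 2 * A < N then n + A
  else if n + A < N then 2 * N - 2 * A - 1 - n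
  else if n + A + 1 < N + k then N - n
  else N - 1 - n

theorem spatialPosition_val {p q k : ℕ} (hp : 0 < p) (h : 2 * p < q) (j : Fin q) (i : Fin k) :
    (spatialPosition p q k h (j, i) : ℕ) =
      if (j : ℕ) + p < q then j * k + i else j * k + (k - 1 - i) := by
  have := i.2
  simp only [spatialPosition, Equiv.trans_apply, Equiv.prodShear_apply, Equiv.refl_apply,
    lt_gammaPattern_iff hp]
  split_ifs
  · simp [finProdFinEquiv, mul_comm, add_comm]
  · simp [finProdFinEquiv, mul_comm, add_comm]
    omega

theorem spatialPosition_gluedOnLabels {p q k : ℕ} (hp : 0 < p) (h : 2 * p < q) (hk : 1 < k)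
    (x : Fin q × Fin k) :
    (spatialPosition p q k h (gluedOnLabels p q k h hk x) : ℕ) =
      gluedValue (p * k) (q * k) k (spatialPosition p q k h x) := by
  obtain ⟨j, i⟩ := x
  have hj := j.2
  have hi := i.2
  have hA : k ≤ p * k := Nat.le_mul_of_pos_left k hp
  have hN : 2 * (p * k) + k ≤ q * k := by nlinarith
  -- Products with `k` are atoms for `omega`; the linear relations between them are supplied by hand
  -- in each branch of `γ`.
  have hpred : (p - 1) * k + k = p * k := by
    rw [← Nat.succ_mul, Nat.succ_eq_add_one, Nat.sub_add_cancel hp]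
  have hγ := gammaPattern_val p q h j
  unfold gluedOnLabels
  simp only [gammaPattern_val_eq_pred_iff hp]
  split_ifs with h1 h2 h3
  · rw [spatialPosition_val hp, spatialPosition_val hp]
    simp only [h1]
    rw [if_pos (by omega), if_pos (by omega)]
    simp only [gluedValue, zero_mul, zero_add, if_true]
    omega
  · rw [spatialPosition_val hp, spatialPosition_val hp, if_pos (by simp; omega),
      if_neg (by simp; omega)]
    have hJ : j * k + p * k = q * k := by rw [← Nat.add_mul, h2.1]
    simp only
    unfold gluedValue
    split_ifs <;> omega
  · have h0 : (gammaPattern p q h ⟨0, by omega⟩ : ℕ) = p := by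
      rw [gammaPattern_val, if_pos (by simp; omega)]; simp
    rw [liftingOnLabels, spatialPosition_val hp, spatialPosition_val hp, h0,
      if_pos (by omega), if_neg (by simp; omega)]
    have hJ : j * k + p * k = q * k := by rw [← Nat.add_mul, h2.1]
    simp only [add_zero]
    unfold gluedValue
    split_ifs <;> omega
  · rw [liftingOnLabels, spatialPosition_val hp, spatialPosition_val hp]
    simp only
    rcases lt_or_ge ((j : ℕ) + 2 * p) q with hc | hc
    · have hγ' : (gammaPattern p q h j : ℕ) = j + p := by rw [hγ, if_pos (by omega)]
      have hJ : j * k + 2 * (p * k) + k ≤ q * k := by nlinarith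
      have hJ0 : (j : ℕ) = 0 ∨ 1 * k ≤ j * k := by
        rcases Nat.eq_zero_or_pos (j : ℕ) with h0 | h0
        · exact Or.inl h0
        · exact Or.inr (Nat.mul_le_mul_right k h0)
      rw [hγ', if_pos (by omega), if_pos (by omega), Nat.add_mul]
      unfold gluedValue
      split_ifs <;> omega
    rcases lt_or_ge ((j : ℕ) + p) q with hc' | hc'
    · have hγ' : (gammaPattern p q h j : ℕ) + j + 2 * p + 1 = 2 * q := by
        rw [hγ, if_neg (by omega), if_pos (by omega)]; omega
      have hJ : j * k + p * k + k ≤ q * k := by nlinarith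
      have hJ1 : q * k ≤ j * k + 2 * (p * k) := by nlinarith
      have hJ2 : (gammaPattern p q h j : ℕ) * k + j * k + 2 * (p * k) + k = 2 * (q * k) := by
        calc _ = ((gammaPattern p q h j : ℕ) + j + 2 * p + 1) * k := by ring
          _ = _ := by rw [hγ']; ring
      rw [if_neg (by omega), if_pos (by omega)]
      unfold gluedValue
      split_ifs <;> omega
    · have hγ' : (gammaPattern p q h j : ℕ) + j + 1 = q := by
        rw [hγ, if_neg (by omega), if_neg (by omega)]; omega
      have hJ2 : (gammaPattern p q h j : ℕ) * k + j * k + k = q * k := by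
        calc _ = ((gammaPattern p q h j : ℕ) + j + 1) * k := by ring
          _ = _ := by rw [hγ']
      have hJ3 : (j : ℕ) + p = q ∨ q * k + k ≤ j * k + p * k := by
        rcases hc'.eq_or_lt with h0 | h0
        · exact Or.inl h0.symm
        · right; nlinarith
      have hJ4 : (j : ℕ) + p = q → j * k + p * k = q * k := by
        intro hq; rw [← Nat.add_mul, hq]
      rw [if_pos (by omega), if_neg (by omega)]
      unfold gluedValue
      split_ifs <;> omega

theorem gluedPattern_val {p q k : ℕ} (hp : 0 < p) (h : 2 * p < q) (hk : 1 < k)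
    (n : Fin (q * k)) :
    (gluedPattern p q k h hk n : ℕ) = gluedValue (p * k) (q * k) k n := by
  rw [gluedPattern, spatialPosition_gluedOnLabels hp, Equiv.apply_symm_apply]

/-! ## Combinatorics of the glued pattern -/

/-- Each copy has one exit point. The glued map sends it where the exit of the next copy would go
under the lifting, cyclically in the copies. An orbit thus enters a copy just after its exit, runs
through the whole copy, and passes on. -/
theorem gluedPattern_isCyclicPattern {p q k : ℕ} (hp : 0 < p) (hpq : Nat.Coprime p q)
    (h : 2 * p < q) (hk : 1 < k) : IsCyclicPattern (gluedPattern p q k h hk) := by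
  set γ := gammaPattern p q h with hγdef
  set g := gluedOnLabels p q k h hk with hg
  have hγ := gammaPattern_isCyclicPattern hpq h
  let exit : Fin k → Fin q := fun i => if (i : ℕ) = 0 then ⟨0, by omega⟩ else ⟨q - p, by omega⟩
  have hlift : ∀ i j, j ≠ exit i → g (j, i) = (γ j, i) := by
    intro i j hj
    have hj' : (j : ℕ) ≠ exit i := fun hh => hj (Fin.ext hh)
    simp only [exit] at hj'
    rw [hg, gluedOnLabels]
    simp only [gammaPattern_val_eq_pred_iff hp]
    split_ifs at hj' with h0
    · rw [if_neg (by rintro ⟨h1, h2⟩; exact hj' h1), if_neg (by omega), liftingOnLabels]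
    · rw [if_neg (by omega), if_neg (by rintro ⟨h1, h2⟩; simp at hj'; omega), liftingOnLabels]
  have hval : ∀ i : Fin k, (i : ℕ) ≠ 0 → (γ (exit i) : ℕ) = p - 1 := by
    intro i hi
    rw [hγdef, gammaPattern_val_eq_pred_iff hp]
    simp only [exit, hi, if_false]
    omega
  have hnext : ∀ (i : Fin k) (hi : (i : ℕ) + 1 < k),
      g (exit i, i) = (γ (exit ⟨i + 1, hi⟩), ⟨i + 1, hi⟩) := by
    intro i hi
    have h1 := hval ⟨i + 1, hi⟩ (by simp)
    rw [hg, gluedOnLabels]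
    by_cases h0 : (i : ℕ) = 0
    · have he : (exit i : ℕ) = 0 := by simp [exit, h0]
      rw [if_pos ⟨he, h0⟩, Prod.mk.injEq]
      exact ⟨Fin.ext h1.symm, Fin.ext (by simp [h0])⟩
    · rw [if_neg (by rintro ⟨_, h2⟩; exact h0 h2), if_pos ⟨hval i h0, by simp; omega⟩, dif_pos hi,
        Prod.mk.injEq]
      exact ⟨Fin.ext h1.symm, rfl⟩
  have hlast : g (exit ⟨k - 1, by omega⟩, ⟨k - 1, by omega⟩) =
      (γ (exit ⟨0, by omega⟩), ⟨0, by omega⟩) := by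
    have h1 := hval ⟨k - 1, by omega⟩ (by simp; omega)
    rw [hg, gluedOnLabels, if_neg (by simp; omega), if_pos ⟨h1, by simp; omega⟩,
      dif_neg (by simp; omega), liftingOnLabels]
    simp [exit, hγdef]
  have hiter : ∀ i j m, (∀ t < m, γ^[t] j ≠ exit i) → g^[m] (j, i) = (γ^[m] j, i) := by
    intro i j m
    induction m with
    | zero => intro _; rfl
    | succ m ih =>
      intro hm
      rw [Function.iterate_succ_apply', ih fun t ht => hm t (by omega), hlift _ _ (hm m (by omega)),
        Function.iterate_succ_apply']
  let R : Fin q × Fin k → Fin q × Fin k → Prop := fun x y => ∃ m, g^[m] x = y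
  have htrans : ∀ x y z, R x y → R y z → R x z := by
    rintro x y z ⟨m, rfl⟩ ⟨l, rfl⟩
    exact ⟨l + m, Function.iterate_add_apply g l m x⟩
  have hfrom : ∀ i j, R (γ (exit i), i) (j, i) := by
    intro i j
    classical
    have hex := hγ (γ (exit i)) j
    refine ⟨Nat.find hex, ?_⟩
    rw [hiter, Nat.find_spec hex]
    intro t ht he
    have h1 : γ^[Nat.find hex - (t + 1)] (γ (exit i)) = j := by
      conv_rhs => rw [← Nat.find_spec hex,
        ← Nat.sub_add_cancel (show t + 1 ≤ Nat.find hex from ht), Function.iterate_add_apply,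
        Function.iterate_succ_apply', he]
    have := Nat.find_min' hex h1
    omega
  have hto : ∀ i j, R (j, i) (exit i, i) := by
    intro i j
    classical
    have hex := hγ j (exit i)
    refine ⟨Nat.find hex, ?_⟩
    rw [hiter _ _ _ fun t ht => Nat.find_min hex ht, Nat.find_spec hex]
  have hstep : ∀ x y, g x = y → R x y := fun x y hxy => ⟨1, hxy⟩
  have hup : ∀ (a d : ℕ) (had : a + d < k),
      R (exit ⟨a, by omega⟩, ⟨a, by omega⟩) (exit ⟨a + d, had⟩, ⟨a + d, had⟩) := by
    intro a d
    induction d with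
    | zero => intro _; exact ⟨0, rfl⟩
    | succ d ih =>
      intro had
      exact htrans _ _ _ (ih (by omega)) (htrans _ _ _
        (hstep _ _ (hnext ⟨a + d, by omega⟩ had)) (hto _ _))
  have hto0 : ∀ i : Fin k, R (exit i, i) (exit ⟨0, by omega⟩, ⟨0, by omega⟩) := by
    intro i
    have h1 := hup i (k - 1 - i) (by omega)
    simp only [show (i : ℕ) + (k - 1 - i) = k - 1 by omega] at h1
    exact htrans _ _ _ h1 (htrans _ _ _ (hstep _ _ hlast) (hto _ _))
  have hto1 : ∀ i : Fin k, R (exit i, i) (γ (exit ⟨0, by omega⟩), ⟨0, by omega⟩) := by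
    intro i
    have h1 := hup i (k - 1 - i) (by omega)
    simp only [show (i : ℕ) + (k - 1 - i) = k - 1 by omega] at h1
    exact htrans _ _ _ h1 (hstep _ _ hlast)
  have hentry : ∀ i : Fin k, R (exit ⟨0, by omega⟩, ⟨0, by omega⟩) (γ (exit i), i) := by
    rintro ⟨i, hi⟩
    rcases i with _ | i
    · exact hto1 _
    · have h1 := hup 0 i (by omega)
      simp only [zero_add] at h1
      exact htrans _ _ _ h1 (hstep _ _ (hnext ⟨i, by omega⟩ hi))
  have hall : ∀ x y, R x y := fun x y =>
    htrans _ _ _ (hto x.2 x.1) (htrans _ _ _ (hto0 _) (htrans _ _ _ (hentry y.2) (hfrom _ _)))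
  have hconj : ∀ m n, (gluedPattern p q k h hk)^[m] n =
      spatialPosition p q k h (g^[m] ((spatialPosition p q k h).symm n)) := by
    intro m n
    induction m with
    | zero => simp
    | succ m ih =>
      rw [Function.iterate_succ_apply', ih, gluedPattern, Equiv.symm_apply_apply,
        Function.iterate_succ_apply']
  intro a b
  obtain ⟨m, hm⟩ := hall ((spatialPosition p q k h).symm a) ((spatialPosition p q k h).symm b)
  exact ⟨m, by rw [hconj, hm, Equiv.apply_symm_apply]⟩

theorem copies_le_mul {p k : ℕ} (hp : 0 < p) : k ≤ p * k := Nat.le_mul_of_pos_left k hp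

theorem two_mul_add_le_mul {p q k : ℕ} (h : 2 * p < q) : 2 * (p * k) + k ≤ q * k := by
  nlinarith [Nat.mul_le_mul_right k (Nat.succ_le_of_lt h)]

theorem gluedPattern_isUnimodalPattern {p q k : ℕ} (hp : 0 < p) (h : 2 * p < q) (hk : 1 < k) :
    IsUnimodalPattern (gluedPattern p q k h hk) := by
  have hA : k ≤ p * k := copies_le_mul hp
  have hN : 2 * (p * k) + k ≤ q * k := two_mul_add_le_mul h
  refine ⟨⟨q * k - 2 * (p * k), by omega⟩, ⟨⟨0, by omega⟩, ?_⟩, ⟨⟨q * k - 1, by omega⟩, ?_⟩, ?_, ?_⟩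
  · rw [Fin.lt_def]; simp only; omega
  · rw [Fin.lt_def]; simp only; omega
  · intro x hx y hy hxy
    simp only [Set.mem_Iic, Fin.le_def, Fin.lt_def] at hx hy hxy
    rw [Fin.lt_def, gluedPattern_val hp, gluedPattern_val hp]
    unfold gluedValue
    split_ifs <;> omega
  · intro x hx y hy hxy
    simp only [Set.mem_Ici, Fin.le_def, Fin.lt_def] at hx hy hxy
    have := y.2
    rw [Fin.lt_def, gluedPattern_val hp, gluedPattern_val hp]
    unfold gluedValue
    split_ifs <;> omega

theorem signChanges_gluedPattern {p q k : ℕ} (hp : 0 < p) (hpq : Nat.Coprime p q)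
    (h : 2 * p < q) (hk : 1 < k) : signChanges (gluedPattern p q k h hk) = 2 * (k * p) := by
  have hA : k ≤ p * k := copies_le_mul hp
  have hN : 2 * (p * k) + k ≤ q * k := two_mul_add_le_mul h
  rw [signChanges_eq_two_mul (gluedPattern_isCyclicPattern hp hpq h hk).bijective
    (fun j => q * k ≤ (j : ℕ) + p * k)]
  · rw [card_filter_le_add (by omega) (by omega), Nat.mul_comm p k]
  · intro i hi
    rw [Fin.lt_def, gluedPattern_val hp]
    unfold gluedValue
    split_ifs <;> omega
  · intro i hi
    rw [Fin.lt_def, gluedPattern_val hp]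
    have := i.2
    unfold gluedValue
    split_ifs <;> omega

theorem overRotationNumber_gluedPattern {p q k : ℕ} (hp : 0 < p) (hpq : Nat.Coprime p q)
    (h : 2 * p < q) (hk : 1 < k) :
    overRotationNumber (gluedPattern p q k h hk) = (p : ℝ) / q := by
  rw [overRotationNumber, signChanges_gluedPattern hp hpq]
  have : (k : ℝ) ≠ 0 := by positivity
  have : (q : ℝ) ≠ 0 := by have : 0 < q := by omega
                           positivity
  push_cast
  field_simp

/-- The code of the glued pattern: it changes by `-p` on moves from the left of the fixed point and
by `q - p` on moves from the right. -/
def gluedCode (p q k n : ℕ) : ℤ :=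
  if n + p * k < q * k then -(n : ℤ) / k else ((n : ℤ) + 1) / k + p - 2 * q

/-- Integer division rounds down, so the code on the left is minus the ceiling of `n / k`, with
level sets `{0}`, `{1, …, k}`, and so on. The regular branches are translations and reflections
respecting these levels. The point 0 and the `k - 1` redirected points, of codes `0` and `-q`, are
all sent to level `-p`. -/
theorem gluedCode_gluedValue {p q k n : ℕ} (hp : 0 < p) (h : 2 * p < q) (hk : 1 < k)
    (hn : n < q * k) :
    gluedCode p q k (gluedValue (p * k) (q * k) k n) =
      gluedCode p q k n - p + (if n + p * k < q * k then 0 else (q : ℤ)) := by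
  have hA : k ≤ p * k := copies_le_mul hp
  have hN : 2 * (p * k) + k ≤ q * k := two_mul_add_le_mul h
  have hk0 : (k : ℤ) ≠ 0 := by omega
  unfold gluedValue
  split_ifs with h1 h2 h3 h4 h5 h6
  · have e : (-((p * k + 1 - k : ℕ) : ℤ)) = (k - 1 : ℤ) + (-p : ℤ) * k := by
      rw [Nat.cast_sub (by omega)]; push_cast; ring
    rw [gluedCode, if_pos (by omega), gluedCode, if_pos (by omega), e,
      Int.add_mul_ediv_right _ _ hk0, Int.ediv_eq_zero_of_lt (by omega) (by omega), h1]
    simp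
  · omega
  · have e : (-((n + p * k : ℕ) : ℤ)) = -(n : ℤ) + (-p : ℤ) * k := by push_cast; ring
    rw [gluedCode, if_pos (by omega), gluedCode, if_pos (by omega), e,
      Int.add_mul_ediv_right _ _ hk0]
    ring
  · omega
  · have e : (((2 * (q * k) - 2 * (p * k) - 1 - n : ℕ) : ℤ) + 1) =
        -(n : ℤ) + (2 * q - 2 * p : ℤ) * k := by
      rw [Nat.cast_sub (by omega), Nat.cast_sub (by omega), Nat.cast_sub (by omega)]
      push_cast; ring
    rw [gluedCode, if_neg (by omega), gluedCode, if_pos (by omega), e,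
      Int.add_mul_ediv_right _ _ hk0]
    ring
  · have e : (-((q * k - n : ℕ) : ℤ)) = (n + p * k - q * k : ℤ) + (-p : ℤ) * k := by
      rw [Nat.cast_sub (by omega)]; push_cast; ring
    have e' : ((n : ℤ) + 1) = (n + 1 + p * k - q * k : ℤ) + (q - p : ℤ) * k := by ring
    have hcast : ((p * k : ℕ) : ℤ) = p * k ∧ ((q * k : ℕ) : ℤ) = q * k := by simp
    rw [gluedCode, if_pos (by omega), gluedCode, if_neg (by omega), e, e',
      Int.add_mul_ediv_right _ _ hk0, Int.add_mul_ediv_right _ _ hk0,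
      Int.ediv_eq_zero_of_lt (by omega) (by omega), Int.ediv_eq_zero_of_lt (by omega) (by omega)]
    ring
  · have e : (-((q * k - 1 - n : ℕ) : ℤ)) = ((n : ℤ) + 1) + (-q : ℤ) * k := by
      rw [Nat.cast_sub (by omega), Nat.cast_sub (by omega)]; push_cast; ring
    rw [gluedCode, if_pos (by omega), gluedCode, if_neg (by omega), e,
      Int.add_mul_ediv_right _ _ hk0]
    ring

theorem gluedCode_antitone {p q k m n : ℕ} (hk : 0 < k) (hmn : m ≤ n) (hn : n + p * k < q * k) :
    gluedCode p q k n ≤ gluedCode p q k m := by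
  rw [gluedCode, if_pos hn, gluedCode, if_pos (by omega)]
  exact Int.ediv_le_ediv (by omega) (by omega)

theorem gluedCode_monotone {p q k m n : ℕ} (hk : 0 < k) (hmn : m ≤ n) (hm : q * k ≤ m + p * k) :
    gluedCode p q k m ≤ gluedCode p q k n := by
  rw [gluedCode, if_neg (by omega), gluedCode, if_neg (by omega)]
  have : ((m : ℤ) + 1) / k ≤ ((n : ℤ) + 1) / k := by
    exact Int.ediv_le_ediv (by omega) (by omega)
  omega

/-! ## Forcing of `γ` -/

theorem spatialPosition_lt {p q k : ℕ} (hp : 0 < p) (h : 2 * p < q) {j j' : Fin q} (hj : j < j')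
    (i i' : Fin k) : spatialPosition p q k h (j, i) < spatialPosition p q k h (j', i') := by
  rw [Fin.lt_def, spatialPosition_val hp, spatialPosition_val hp]
  have h1 : (j : ℕ) * k + k ≤ j' * k := by
    rw [← Nat.succ_mul]; exact Nat.mul_le_mul_right k hj
  have := i.2
  split_ifs <;> omega

/-- Only the pairs at `j = 0` and `j = q - p` feel the gluing. In each, one end keeps its lifted
image and the other is moved away from it, so the image span only grows. -/
theorem covers_of_exhibited {p q k : ℕ} (hp : 0 < p) (h : 2 * p < q) (hk : 1 < k) {f : ℝ → ℝ}
    {x : Fin (q * k) → ℝ} (hx : StrictMono x)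
    (hfx : ∀ i, f (x i) = x (gluedPattern p q k h hk i)) (j : Fin q) :
    Covers f
      (x (spatialPosition p q k h (j, ⟨0, by omega⟩)),
        x (spatialPosition p q k h (j, ⟨1, hk⟩)))
      (x (spatialPosition p q k h (gammaPattern p q h j, ⟨0, by omega⟩)),
        x (spatialPosition p q k h (gammaPattern p q h j, ⟨1, hk⟩))) := by
  have hA : k ≤ p * k := copies_le_mul hp
  have hN : 2 * (p * k) + k ≤ q * k := two_mul_add_le_mul h
  have hpred : (p - 1) * k + k = p * k := by
    rw [← Nat.succ_mul, Nat.succ_eq_add_one, Nat.sub_add_cancel hp]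
  have hf : ∀ l, f (x (spatialPosition p q k h l)) =
      x (spatialPosition p q k h (gluedOnLabels p q k h hk l)) := by
    intro l
    rw [hfx, gluedPattern, Equiv.symm_apply_apply]
  have hmem : ∀ a b c : Fin (q * k), a ≤ b → b ≤ c → x b ∈ Set.uIcc (x a) (x c) :=
    fun a b c hab hbc => Set.mem_uIcc.2 (Or.inl ⟨hx.monotone hab, hx.monotone hbc⟩)
  have hj := j.2
  simp only [Covers, hf]
  by_cases h0 : (j : ℕ) = 0
  · have h1 : gluedOnLabels p q k h hk (j, ⟨0, by omega⟩) = (⟨p - 1, by omega⟩, ⟨1, hk⟩) := by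
      simp [gluedOnLabels, h0]
    have h2 : gluedOnLabels p q k h hk (j, ⟨1, hk⟩) = (gammaPattern p q h j, ⟨1, hk⟩) := by
      rw [gluedOnLabels, if_neg (by simp), if_neg
        (by simp only [gammaPattern_val_eq_pred_iff hp]; omega), liftingOnLabels]
    have h3 : (gammaPattern p q h j : ℕ) = p := by
      rw [gammaPattern_val, if_pos (by omega), h0, zero_add]
    rw [h1, h2]
    refine Set.uIcc_subset_uIcc (hmem _ _ _ ?_ ?_) Set.right_mem_uIcc
    · exact (spatialPosition_lt hp h (Fin.lt_def.2 (by simp [h3]; omega)) _ _).le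
    · rw [Fin.le_def, spatialPosition_val hp, spatialPosition_val hp, h3, if_pos (by omega),
        if_pos (by omega)]
      simp
  · have h1 : gluedOnLabels p q k h hk (j, ⟨0, by omega⟩) =
        (gammaPattern p q h j, ⟨0, by omega⟩) := by
      simp [gluedOnLabels, h0, liftingOnLabels]
    by_cases h2 : (j : ℕ) + p = q
    · have h3 : (gammaPattern p q h j : ℕ) = p - 1 := (gammaPattern_val_eq_pred_iff hp h j).2 h2
      have hJ : j * k + p * k = q * k := by rw [← Nat.add_mul, h2]
      rw [h1]
      refine Set.uIcc_subset_uIcc Set.left_mem_uIcc (hmem _ _ _ ?_ ?_)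
      · rw [Fin.le_def, spatialPosition_val hp, spatialPosition_val hp, h3, if_pos (by omega),
          if_pos (by omega)]
        simp
      · rw [Fin.le_def, spatialPosition_gluedOnLabels hp, spatialPosition_val hp,
          spatialPosition_val hp, h3, if_pos (by omega), if_neg (by omega)]
        simp only
        unfold gluedValue
        split_ifs <;> omega
    · have h3 : gluedOnLabels p q k h hk (j, ⟨1, hk⟩) = (gammaPattern p q h j, ⟨1, hk⟩) := by
        rw [gluedOnLabels, if_neg (by simp), if_neg
          (by simp only [gammaPattern_val_eq_pred_iff hp]; omega), liftingOnLabels]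
      rw [h1, h3]

/-- Following the pairs along the cycle `γ` closes a loop of coverings. The pairs for different `j`
are disjoint and ordered as the `j`, so the resulting periodic orbit has pattern `γ`. -/
theorem gluedPattern_forces_gammaPattern {p q k : ℕ} (hp : 0 < p) (hpq : Nat.Coprime p q)
    (h : 2 * p < q) (hk : 1 < k) : Forces (gluedPattern p q k h hk) (gammaPattern p q h) := by
  rintro f a b hf ⟨x, hx, hxm, hfx⟩
  set γ := gammaPattern p q h with hγdef
  have hγ := gammaPattern_isCyclicPattern hpq h
  set I : Fin q → ℝ × ℝ := fun j => (x (spatialPosition p q k h (j, ⟨0, by omega⟩)),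
    x (spatialPosition p q k h (j, ⟨1, hk⟩))) with hI
  have hcov : ∀ j, Covers f (I j) (I (γ j)) := covers_of_exhibited hp h hk hx hfx
  have hIm : ∀ j, Set.uIcc (I j).1 (I j).2 ⊆ Set.Icc a b :=
    fun j => Set.uIcc_subset_Icc (hxm _) (hxm _)
  set o : Fin q := ⟨0, by omega⟩ with ho
  set M := Function.minimalPeriod γ o with hM
  obtain ⟨m₀, hm₀⟩ := hγ (γ o) o
  have hM0 : 0 < M := Function.IsPeriodicPt.minimalPeriod_pos (n := m₀ + 1) (by omega)
    (by rwa [Function.IsPeriodicPt, Function.IsFixedPt, Function.iterate_succ_apply])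
  obtain ⟨z, hz, hzI⟩ := exists_periodic_of_covers hf M (fun i => I (γ^[i] o))
    (fun i _ => hIm _) (fun i _ => by simp only [Function.iterate_succ_apply']; exact hcov _)
    (by rw [hM, Function.iterate_minimalPeriod]; rfl)
  have hmod : ∀ i, f^[i % M] z = f^[i] z := fun i => Function.IsPeriodicPt.iterate_mod_apply hz i
  have hzI' : ∀ i, f^[i] z ∈ Set.uIcc (I (γ^[i] o)).1 (I (γ^[i] o)).2 := by
    intro i
    rw [← hmod, ← Function.iterate_mod_minimalPeriod_eq (f := γ)]
    exact hzI _ (Nat.mod_lt _ hM0).le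
  have heq : ∀ i l, γ^[i] o = γ^[l] o → f^[i] z = f^[l] z := by
    intro i l hil
    rw [← Function.iterate_mod_minimalPeriod_eq (f := γ) (n := i),
      ← Function.iterate_mod_minimalPeriod_eq (f := γ) (n := l),
      Function.iterate_eq_iterate_iff_of_lt_minimalPeriod (Nat.mod_lt _ hM0)
        (Nat.mod_lt _ hM0)] at hil
    rw [← hmod i, ← hmod l, hil]
  choose m hm using hγ o
  have hy : ∀ j, f^[m j] z ∈ Set.uIcc (I j).1 (I j).2 := by
    intro j
    have := hzI' (m j)
    rwa [hm] at this
  refine ⟨fun j => f^[m j] z, ?_, fun j => hIm j (hy j), ?_⟩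
  · intro j j' hjj
    have h1 := hy j
    have h2 := hy j'
    have h3 := fun i i' => hx (spatialPosition_lt hp h hjj (k := k) i i')
    have h4 := h3 ⟨0, by omega⟩ ⟨0, by omega⟩
    have h5 := h3 ⟨0, by omega⟩ ⟨1, hk⟩
    have h6 := h3 ⟨1, hk⟩ ⟨0, by omega⟩
    have h7 := h3 ⟨1, hk⟩ ⟨1, hk⟩
    simp only [hI, Set.mem_uIcc] at h1 h2
    show f^[m j] z < f^[m j'] z
    rcases h1 with h1 | h1 <;> rcases h2 with h2 | h2 <;> linarith
  · intro j
    simp only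
    rw [← Function.iterate_succ_apply' f]
    apply heq
    rw [Function.iterate_succ_apply', hm, hm]

theorem not_isOverTwist_gluedPattern {p q k : ℕ} (hp : 0 < p) (hpq : Nat.Coprime p q)
    (h : 2 * p < q) (hk : 1 < k) : ¬ IsOverTwist (gluedPattern p q k h hk) := by
  rintro ⟨-, -, hmin⟩
  have h1 := hmin q (gammaPattern p q h) (by omega) (gammaPattern_isCyclicPattern hpq h)
    (by rw [overRotationNumber_gammaPattern hp hpq, overRotationNumber_gluedPattern hp hpq])
    (gluedPattern_forces_gammaPattern hp hpq h hk)
  have h2 : q = q * k := congrArg Sigma.fst h1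
  have h3 : q * 2 ≤ q * k := Nat.mul_le_mul_left q hk
  omega

/-! ## Block structures -/

theorem not_hasBlockStructureOver_gluedPattern {p q k : ℕ} (hp : 0 < p) (hpq : Nat.Coprime p q)
    (h : 2 * p < q) (hk : 1 < k) {m : ℕ} {θ : Fin m → Fin m} (hθ : IsOverTwist θ) :
    ¬ HasBlockStructureOver (gluedPattern p q k h hk) θ := by
  have hA : k ≤ p * k := copies_le_mul hp
  have hN : 2 * (p * k) + k ≤ q * k := two_mul_add_le_mul h
  rintro ⟨I, hI, hcover, hlt, himg⟩
  set π := gluedPattern p q k h hk with hπdef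
  have hπv : ∀ n : Fin (q * k), (π n : ℕ) = gluedValue (p * k) (q * k) k n := gluedPattern_val hp h hk
  have hm2 := hθ.1
  have hmem : ∀ x, ∃ j, x ∈ I j := fun x => Set.mem_iUnion.1 (hcover ▸ Set.mem_univ x)
  have huniq : ∀ x i j, x ∈ I i → x ∈ I j → i = j := by
    intro x i j hi hj
    rcases lt_trichotomy i j with hij | hij | hij
    · exact absurd (hlt i j hij x hi x hj) (lt_irrefl _)
    · exact hij
    · exact absurd (hlt j i hij x hj x hi) (lt_irrefl _)
  have hmap : ∀ x j, x ∈ I j → π x ∈ I (θ j) := fun x j hx => himg j ▸ Set.mem_image_of_mem π hx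
  set o : Fin m := ⟨0, by omega⟩ with ho
  set z : Fin (q * k) := ⟨0, by omega⟩ with hz
  have hz0 : z ∈ I o := by
    obtain ⟨j, hj⟩ := hmem z
    rcases (show o ≤ j from Nat.zero_le _).eq_or_lt with hoj | hoj
    · exact hoj ▸ hj
    · obtain ⟨y, hy⟩ := (hI o).1
      exact absurd (hlt o j hoj y hy z hj) (Nat.not_lt_zero _)
  -- If the first block is a point, so are all blocks by transitivity of `θ`, and the glued pattern
  -- would itself be the over-twist.
  by_cases hsub : (I o).Subsingleton
  · have hsing : ∀ t, (I (θ^[t] o)).Subsingleton := by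
      intro t
      induction t with
      | zero => exact hsub
      | succ t ih => rw [Function.iterate_succ_apply', ← himg]; exact ih.image π
    have hsing' : ∀ j, (I j).Subsingleton := by
      intro j
      obtain ⟨t, rfl⟩ := hθ.2.1 o j
      exact hsing t
    choose e he using fun j => (hI j).1
    have hmono : StrictMono e := fun i j hij => hlt i j hij _ (he i) _ (he j)
    have hsurj : Function.Surjective e := by
      intro x
      obtain ⟨j, hj⟩ := hmem x
      exact ⟨j, hsing' j (he j) hj⟩
    have hcard : m = q * k := by
      simpa using Fintype.card_of_bijective ⟨hmono.injective, hsurj⟩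
    have key : ∀ (n : ℕ) (hn : m = n) (ψ : Fin n → Fin n) (e : Fin m → Fin n), StrictMono e →
        Function.Surjective e → (∀ j, ψ (e j) = e (θ j)) → IsOverTwist ψ := by
      rintro n rfl ψ e hmono hsurj hconj
      have hid : ∀ j, e j = j := by
        intro j
        have := Subsingleton.elim (StrictMono.orderIsoOfSurjective e hmono hsurj)
          (OrderIso.refl (Fin m))
        exact DFunLike.congr_fun this j
      have : ψ = θ := by
        funext j
        have := hconj j
        rwa [hid, hid] at this
      rw [this]
      exact hθ
    exact not_isOverTwist_gluedPattern hp hpq h hk (key _ hcard π e hmono hsurj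
      fun j => hsing' _ (hmap _ _ (he j)) (he _))
  · have hconn : ∀ j x y w, x ∈ I j → y ∈ I j → x ≤ w → w ≤ y → w ∈ I j :=
      fun j x y w hx hy h1 h2 => (hI j).2.out hx hy ⟨h1, h2⟩
    obtain ⟨y, hy, hyz⟩ : ∃ y ∈ I o, y ≠ z := by
      by_contra! hall
      exact hsub fun a ha b hb => (hall a ha).trans (hall b hb).symm
    have hy0 : (y : ℕ) ≠ 0 := fun hh => hyz (Fin.ext hh)
    set u : Fin (q * k) := ⟨1, by omega⟩ with hu
    have hu0 : u ∈ I o := hconn o z y u hz0 hy (Nat.zero_le _) (by rw [Fin.le_def]; simp [hu]; omega)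
    have hπz : (π z : ℕ) = p * k + 1 - k := by rw [hπv, gluedValue, if_pos rfl]
    have hπu : (π u : ℕ) = p * k + 1 := by
      rw [hπv, gluedValue, if_neg (by simp [hu]), if_pos (by simp [hu]; omega)]
      simp [hu]; omega
    -- The images of 0 and 1 leave a gap, so this value just above the image of 0 is taken only on
    -- the decreasing branch. Hence the block reaches the turning point `c`.
    obtain ⟨w, hw, hwv⟩ : ∃ w ∈ I o, (π w : ℕ) = p * k + 2 - k := by
      have : (⟨p * k + 2 - k, by omega⟩ : Fin (q * k)) ∈ I (θ o) := by
        refine hconn _ _ _ _ (hmap z o hz0) (hmap u o hu0) ?_ ?_ <;> rw [Fin.le_def]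
        · rw [hπz]; simp only; omega
        · rw [hπu]; simp only; omega
      rw [← himg] at this
      obtain ⟨w, hw, hww⟩ := this
      exact ⟨w, hw, by rw [hww]⟩
    have hwc : q * k - 2 * (p * k) ≤ w := by
      rw [hπv] at hwv
      have := w.2
      unfold gluedValue at hwv
      split_ifs at hwv <;> omega
    set c : Fin (q * k) := ⟨q * k - 2 * (p * k), by omega⟩ with hc
    have hc0 : c ∈ I o := hconn o z w c hz0 hw (Nat.zero_le _) hwc
    have hπc : (π c : ℕ) = q * k - 1 := by
      rw [hπv]
      simp only [hc]
      unfold gluedValue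
      split_ifs <;> omega
    have hππc : π (π c) = z := by
      ext
      rw [hπv, hπc]
      simp only [hz]
      unfold gluedValue
      split_ifs <;> omega
    have hθθ : θ (θ o) = o := huniq z _ _ (hππc ▸ hmap _ _ (hmap _ _ hc0)) hz0
    have hθo : o < θ o := lt_of_le_of_ne (Nat.zero_le _) (hθ.2.1.apply_ne hm2 o).symm
    -- Since `θ` swaps the two blocks, the second image of 0 must lie left of the first; but the
    -- first image is left of the fixed point and moves right.
    have h1 := hlt _ _ hθo (π (π z)) (by
      have := hmap _ _ (hmap _ _ hz0)
      rwa [hθθ] at this) (π z) (hmap _ _ hz0)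
    rw [Fin.lt_def, hπv (π z), hπz] at h1
    unfold gluedValue at h1
    split_ifs at h1 <;> omega

/-! ## The linear map of a pattern -/

theorem linearMap_of_mem_Icc {n : ℕ} (π : Fin n → Fin n) (m : ℕ) {t : ℝ}
    (ht : t ∈ Set.Icc (m : ℝ) (m + 1)) :
    linearMap π t = patternValue π m + (t - m) * (patternValue π (m + 1) - patternValue π m) := by
  have h0 : 0 ≤ t := (Nat.cast_nonneg m).trans ht.1
  rcases ht.2.eq_or_lt with h | h
  · have : ⌊t⌋₊ = m + 1 := by
      rw [h]; exact_mod_cast Nat.floor_natCast (R := ℝ) (m + 1)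
    rw [linearMap, this, h]
    push_cast
    ring
  · have : ⌊t⌋₊ = m := (Nat.floor_eq_iff h0).2 ⟨ht.1, h⟩
    rw [linearMap, this]

theorem add_mul_sub_mem_uIcc {s u v : ℝ} (h0 : 0 ≤ s) (h1 : s ≤ 1) :
    u + s * (v - u) ∈ Set.uIcc u v := by
  rw [Set.mem_uIcc]
  rcases le_total u v with h | h
  · exact Or.inl ⟨by nlinarith, by nlinarith⟩
  · exact Or.inr ⟨by nlinarith, by nlinarith⟩

theorem linearMap_mem_uIcc {n : ℕ} (π : Fin n → Fin n) (m : ℕ) {t : ℝ}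
    (ht : t ∈ Set.Icc (m : ℝ) (m + 1)) :
    linearMap π t ∈ Set.uIcc (patternValue π m) (patternValue π (m + 1)) := by
  rw [linearMap_of_mem_Icc π m ht]
  exact add_mul_sub_mem_uIcc (by linarith [ht.1]) (by linarith [ht.2])

theorem patternValue_mem_Icc {n : ℕ} (π : Fin n → Fin n) (hn : 0 < n) (m : ℕ) :
    patternValue π m ∈ Set.Icc (0 : ℝ) ((n : ℝ) - 1) := by
  unfold patternValue
  have h1 : (1 : ℝ) ≤ n := by exact_mod_cast hn
  split_ifs with h
  · have : ((π ⟨m, h⟩ : ℕ) : ℝ) + 1 ≤ n := by exact_mod_cast (π ⟨m, h⟩).2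
    exact ⟨by positivity, by linarith⟩
  · exact ⟨le_rfl, by linarith⟩

theorem isIntervalMap_linearMap {n : ℕ} (π : Fin n → Fin n) (hn : 0 < n) :
    IsIntervalMap (linearMap π) 0 ((n : ℝ) - 1) := by
  constructor
  · have key : ∀ m : ℕ, ContinuousOn (linearMap π) (Set.Icc (0 : ℝ) m) := by
      intro m
      induction m with
      | zero => simp
      | succ m ih =>
        have h1 : ContinuousOn (linearMap π) (Set.Icc (m : ℝ) (m + 1)) := by
          refine ContinuousOn.congr ?_ fun t ht => linearMap_of_mem_Icc π m ht
          fun_prop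
        have h2 : Set.Icc (0 : ℝ) m ∪ Set.Icc (m : ℝ) (m + 1) = Set.Icc (0 : ℝ) ((m + 1 : ℕ) : ℝ) := by
          push_cast
          exact Set.Icc_union_Icc_eq_Icc (by positivity) (by linarith)
        rw [← h2]
        exact ih.union_of_isClosed h1 isClosed_Icc isClosed_Icc
    have := key (n - 1)
    rwa [Nat.cast_sub hn, Nat.cast_one] at this
  · intro t ht
    have hm : t ∈ Set.Icc (⌊t⌋₊ : ℝ) (⌊t⌋₊ + 1) :=
      ⟨Nat.floor_le ht.1, (Nat.lt_floor_add_one t).le⟩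
    exact Set.uIcc_subset_Icc (patternValue_mem_Icc π hn _) (patternValue_mem_Icc π hn _)
      (linearMap_mem_uIcc π _ hm)

/-! ## The linear map of the glued pattern -/

theorem patternValue_gluedPattern {p q k : ℕ} (hp : 0 < p) (h : 2 * p < q) (hk : 1 < k) {n : ℕ}
    (hn : n < q * k) :
    patternValue (gluedPattern p q k h hk) n = gluedValue (p * k) (q * k) k n := by
  rw [patternValue, dif_pos hn, gluedPattern_val hp]

/-- The fixed point of the linear map of the glued pattern. -/
noncomputable def gluedFixedPoint (p q k : ℕ) : ℝ :=
  ((q * k : ℕ) : ℝ) - (p * k : ℕ) - 1 + 1 / ((q * k : ℕ) - 2 * (p * k : ℕ) + 1)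

section

variable {p q k : ℕ}

theorem cast_two_mul_add_le_mul (h : 2 * p < q) :
    2 * ((p * k : ℕ) : ℝ) + k ≤ (q * k : ℕ) := by
  exact_mod_cast two_mul_add_le_mul (k := k) h

theorem lt_gluedFixedPoint (h : 2 * p < q) :
    ((q * k : ℕ) : ℝ) - (p * k : ℕ) - 1 < gluedFixedPoint p q k := by
  have hN := cast_two_mul_add_le_mul (k := k) h
  have hk0 : (0 : ℝ) ≤ k := Nat.cast_nonneg k
  rw [gluedFixedPoint]
  have : 0 < 1 / (((q * k : ℕ) : ℝ) - 2 * (p * k : ℕ) + 1) := by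
    apply one_div_pos.2; linarith
  linarith

theorem gluedFixedPoint_lt (h : 2 * p < q) (hk : 0 < k) :
    gluedFixedPoint p q k < ((q * k : ℕ) : ℝ) - (p * k : ℕ) := by
  have hN := cast_two_mul_add_le_mul (k := k) h
  have hk0 : (0 : ℝ) < k := Nat.cast_pos.2 hk
  rw [gluedFixedPoint]
  have : 1 / (((q * k : ℕ) : ℝ) - 2 * (p * k : ℕ) + 1) < 1 := by
    rw [div_lt_one] <;> linarith
  linarith

theorem natCast_lt_gluedFixedPoint_iff (h : 2 * p < q) (hk : 0 < k) (n : ℕ) :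
    (n : ℝ) < gluedFixedPoint p q k ↔ n + p * k < q * k := by
  have h1 := lt_gluedFixedPoint (k := k) h
  have h2 := gluedFixedPoint_lt h hk
  constructor
  · intro hn
    have : (n : ℝ) + (p * k : ℕ) < (q * k : ℕ) := by linarith
    exact_mod_cast this
  · intro hn
    have : (n : ℝ) + (p * k : ℕ) + 1 ≤ (q * k : ℕ) := by exact_mod_cast hn
    linarith

theorem gluedFixedPoint_lt_natCast_iff (h : 2 * p < q) (hk : 0 < k) (n : ℕ) :
    gluedFixedPoint p q k < n ↔ q * k ≤ n + p * k := by
  have h1 := lt_gluedFixedPoint (k := k) h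
  have h2 := gluedFixedPoint_lt h hk
  constructor
  · intro hn
    by_contra! hlt
    exact absurd hn ((natCast_lt_gluedFixedPoint_iff h hk n).2 hlt).not_gt
  · intro hn
    have : ((q * k : ℕ) : ℝ) ≤ (n : ℝ) + (p * k : ℕ) := by exact_mod_cast hn
    linarith

/-- With `N = q * k` and `A = p * k`, the basic interval from `N - A - 1` to `N - A` has end images
`N - A` and `A`, hence slope `-(N - 2 * A)`; this determines the fixed point. -/
theorem linearMap_gluedPattern_middle (hp : 0 < p) (h : 2 * p < q) (hk : 1 < k) {t : ℝ}
    (ht : t ∈ Set.Icc (((q * k : ℕ) : ℝ) - (p * k : ℕ) - 1) (((q * k : ℕ) : ℝ) - (p * k : ℕ))) :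
    linearMap (gluedPattern p q k h hk) t = gluedFixedPoint p q k +
      (gluedFixedPoint p q k - t) * ((q * k : ℕ) - 2 * (p * k : ℕ)) := by
  have hA : k ≤ p * k := copies_le_mul hp
  have hN : 2 * (p * k) + k ≤ q * k := two_mul_add_le_mul h
  have hN' := cast_two_mul_add_le_mul (k := k) h
  have hk0 : (0 : ℝ) < k := by positivity
  have hc : ((q * k - p * k - 1 : ℕ) : ℝ) = ((q * k : ℕ) : ℝ) - (p * k : ℕ) - 1 := by
    rw [Nat.cast_sub (by omega), Nat.cast_sub (by omega), Nat.cast_one]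
  have hv1 : gluedValue (p * k) (q * k) k (q * k - p * k - 1) = q * k - p * k := by
    unfold gluedValue
    split_ifs <;> omega
  have hv2 : gluedValue (p * k) (q * k) k (q * k - p * k - 1 + 1) = p * k := by
    rw [gluedValue, if_neg (by omega)]
    split_ifs <;> omega
  rw [linearMap_of_mem_Icc _ (q * k - p * k - 1) (by rw [hc]; simpa using ht),
    patternValue_gluedPattern hp h hk (by omega), patternValue_gluedPattern hp h hk (by omega),
    hv1, hv2, hc, gluedFixedPoint, Nat.cast_sub (by omega)]
  generalize ((q * k : ℕ) : ℝ) = N at *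
  generalize ((p * k : ℕ) : ℝ) = A at *
  have e : 1 / (N - 2 * A + 1) * (N - 2 * A + 1) = 1 := one_div_mul_cancel (by linarith)
  linear_combination -e

theorem linearMap_gluedFixedPoint (hp : 0 < p) (h : 2 * p < q) (hk : 1 < k) :
    linearMap (gluedPattern p q k h hk) (gluedFixedPoint p q k) = gluedFixedPoint p q k := by
  rw [linearMap_gluedPattern_middle hp h hk
    ⟨(lt_gluedFixedPoint h).le, (gluedFixedPoint_lt h (by omega)).le⟩]
  ring

theorem lt_linearMap_gluedPattern (hp : 0 < p) (h : 2 * p < q) (hk : 1 < k) {t : ℝ} (ht : 0 ≤ t)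
    (hta : t < gluedFixedPoint p q k) : t < linearMap (gluedPattern p q k h hk) t := by
  have hA : k ≤ p * k := copies_le_mul hp
  have hN : 2 * (p * k) + k ≤ q * k := two_mul_add_le_mul h
  have hN' := cast_two_mul_add_le_mul (k := k) h
  have hk0 : (0 : ℝ) < k := by positivity
  have h2 := gluedFixedPoint_lt h (show 0 < k by omega)
  rcases le_or_gt (((q * k : ℕ) : ℝ) - (p * k : ℕ) - 1) t with hc | hc
  · rw [linearMap_gluedPattern_middle hp h hk ⟨hc, by linarith⟩]
    nlinarith
  · have hm : t ∈ Set.Icc (⌊t⌋₊ : ℝ) (⌊t⌋₊ + 1) :=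
      ⟨Nat.floor_le ht, (Nat.lt_floor_add_one t).le⟩
    rw [linearMap_of_mem_Icc _ _ hm]
    set m := ⌊t⌋₊
    have hm1 : m + p * k + 1 < q * k := by
      have : (m : ℝ) + (p * k : ℕ) + 1 < (q * k : ℕ) := by linarith [hm.1]
      exact_mod_cast this
    rw [patternValue_gluedPattern hp h hk (by omega), patternValue_gluedPattern hp h hk (by omega)]
    have hv1 : m + 1 ≤ gluedValue (p * k) (q * k) k m := by
      unfold gluedValue
      split_ifs <;> omega
    have hv2 : m + 2 ≤ gluedValue (p * k) (q * k) k (m + 1) := by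
      rw [gluedValue, if_neg (by omega)]
      split_ifs <;> omega
    have hv1' : (m : ℝ) + 1 ≤ gluedValue (p * k) (q * k) k m := by exact_mod_cast hv1
    have hv2' : (m : ℝ) + 2 ≤ gluedValue (p * k) (q * k) k (m + 1) := by exact_mod_cast hv2
    have e1 := mul_le_mul_of_nonneg_left hv1' (show 0 ≤ 1 - (t - m) by linarith [hm.2])
    have e2 := mul_le_mul_of_nonneg_left hv2' (show 0 ≤ t - m by linarith [hm.1])
    linarith

theorem linearMap_gluedPattern_lt (hp : 0 < p) (h : 2 * p < q) (hk : 1 < k) {t : ℝ}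
    (ht : t ≤ ((q * k : ℕ) : ℝ) - 1) (hta : gluedFixedPoint p q k < t) :
    linearMap (gluedPattern p q k h hk) t < gluedFixedPoint p q k := by
  have hA : k ≤ p * k := copies_le_mul hp
  have hN : 2 * (p * k) + k ≤ q * k := two_mul_add_le_mul h
  have hN' := cast_two_mul_add_le_mul (k := k) h
  have hk0 : (0 : ℝ) < k := by positivity
  have h1 := lt_gluedFixedPoint (k := k) h
  rcases le_or_gt t (((q * k : ℕ) : ℝ) - (p * k : ℕ)) with hc | hc
  · rw [linearMap_gluedPattern_middle hp h hk ⟨by linarith, hc⟩]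
    nlinarith
  · have ht0 : 0 < t := by
      have : (0 : ℝ) ≤ (p * k : ℕ) := Nat.cast_nonneg _
      linarith
    -- Rounding up keeps `m + 1` inside the cycle even for `t = N - 1`, where rounding down would
    -- meet the default value of `patternValue`.
    obtain ⟨m, hm⟩ : ∃ m, ⌈t⌉₊ = m + 1 := ⟨⌈t⌉₊ - 1, by have := Nat.ceil_pos.2 ht0; omega⟩
    have hmt : t ∈ Set.Icc (m : ℝ) (m + 1) := by
      have h3 := Nat.le_ceil t
      have h4 := Nat.ceil_lt_add_one ht0.le
      rw [hm] at h3 h4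
      push_cast at h3 h4
      exact ⟨by linarith, h3⟩
    have hmN : m + 1 < q * k := by
      have : ⌈t⌉₊ ≤ q * k - 1 := Nat.ceil_le.2 (by rwa [Nat.cast_sub (by omega), Nat.cast_one])
      omega
    have hmA : q * k ≤ m + p * k := by
      have : ((q * k : ℕ) : ℝ) < (m : ℝ) + (p * k : ℕ) + 1 := by linarith [hmt.2]
      have : q * k < m + p * k + 1 := by exact_mod_cast this
      omega
    have hmem := linearMap_mem_uIcc (gluedPattern p q k h hk) m hmt
    rw [patternValue_gluedPattern hp h hk (by omega), patternValue_gluedPattern hp h hk hmN] at hmem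
    have hv1 : gluedValue (p * k) (q * k) k m + p * k < q * k := by
      unfold gluedValue
      split_ifs <;> omega
    have hv2 : gluedValue (p * k) (q * k) k (m + 1) + p * k < q * k := by
      rw [gluedValue, if_neg (by omega)]
      split_ifs <;> omega
    rw [← natCast_lt_gluedFixedPoint_iff h (by omega)] at hv1 hv2
    rcases Set.mem_uIcc.1 hmem with hh | hh <;> linarith

/-! ## The lower bound for the over-rotation numbers -/

open Classical in
/-- The code of the glued pattern extended to the interval: the value at the point of the cycle
next to `t` on the side away from the fixed point. -/
noncomputable def gluedRealCode (p q k : ℕ) (t : ℝ) : ℤ :=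
  if t < gluedFixedPoint p q k then gluedCode p q k ⌊t⌋₊ else gluedCode p q k ⌈t⌉₊

theorem gluedRealCode_le_left (h : 2 * p < q) (hk : 0 < k) {t : ℝ} {n : ℕ} (hnt : (n : ℝ) ≤ t)
    (ht : t < gluedFixedPoint p q k) : gluedRealCode p q k t ≤ gluedCode p q k n := by
  rw [gluedRealCode, if_pos ht]
  refine gluedCode_antitone hk (Nat.le_floor hnt) ?_
  rw [← natCast_lt_gluedFixedPoint_iff h hk]
  exact (Nat.floor_le ((Nat.cast_nonneg n).trans hnt)).trans_lt ht

theorem gluedRealCode_le_right (h : 2 * p < q) (hk : 0 < k) {t : ℝ} {n : ℕ} (hnt : t ≤ n)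
    (ht : gluedFixedPoint p q k ≤ t) : gluedRealCode p q k t ≤ gluedCode p q k n := by
  rw [gluedRealCode, if_neg ht.not_gt]
  refine gluedCode_monotone hk (Nat.ceil_le.2 hnt) ?_
  by_contra! hlt
  rw [← natCast_lt_gluedFixedPoint_iff h hk] at hlt
  linarith [Nat.le_ceil t]

/-- The code does not decrease away from the fixed point, so one of the two end points always
dominates, even if the interval contains that fixed point. -/
theorem gluedRealCode_le_of_mem_uIcc (h : 2 * p < q) (hk : 0 < k) {t : ℝ} {m n : ℕ} {C : ℤ}
    (ht : t ∈ Set.uIcc (m : ℝ) n) (hm : gluedCode p q k m ≤ C) (hn : gluedCode p q k n ≤ C) :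
    gluedRealCode p q k t ≤ C := by
  rcases lt_or_ge t (gluedFixedPoint p q k) with hlt | hge
  · rcases Set.mem_uIcc.1 ht with hh | hh
    · exact (gluedRealCode_le_left h hk hh.1 hlt).trans hm
    · exact (gluedRealCode_le_left h hk hh.1 hlt).trans hn
  · rcases Set.mem_uIcc.1 ht with hh | hh
    · exact (gluedRealCode_le_right h hk hh.2 hge).trans hn
    · exact (gluedRealCode_le_right h hk hh.2 hge).trans hm

/-- The image of `t` lies between the images of its two neighbours in the cycle, and the neighbour
nearer to the fixed point has no larger code. -/
theorem gluedRealCode_linearMap_le_left (hp : 0 < p) (h : 2 * p < q) (hk : 1 < k) {t : ℝ}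
    (ht : 0 ≤ t) (hta : t < gluedFixedPoint p q k) :
    gluedRealCode p q k (linearMap (gluedPattern p q k h hk) t) ≤ gluedRealCode p q k t - p := by
  have hA : k ≤ p * k := copies_le_mul hp
  have hN : 2 * (p * k) + k ≤ q * k := two_mul_add_le_mul h
  have hN' := cast_two_mul_add_le_mul (k := k) h
  have hk0 : (0 : ℝ) < k := by positivity
  have hm : t ∈ Set.Icc (⌊t⌋₊ : ℝ) (⌊t⌋₊ + 1) :=
    ⟨Nat.floor_le ht, (Nat.lt_floor_add_one t).le⟩
  rw [gluedRealCode, gluedRealCode, if_pos hta, ← gluedRealCode]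
  set m := ⌊t⌋₊
  have hmA : m + p * k < q * k := by
    rw [← natCast_lt_gluedFixedPoint_iff h (by omega)]
    exact hm.1.trans_lt hta
  have hcm := gluedCode_gluedValue hp h hk (show m < q * k by omega)
  rw [if_pos hmA, add_zero] at hcm
  have hmem := linearMap_mem_uIcc (gluedPattern p q k h hk) m hm
  rw [patternValue_gluedPattern hp h hk (by omega),
    patternValue_gluedPattern hp h hk (by omega)] at hmem
  rcases lt_or_ge (m + 1 + p * k) (q * k) with hm1 | hm1
  · have hcm1 := gluedCode_gluedValue hp h hk (show m + 1 < q * k by omega)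
    rw [if_pos hm1, add_zero] at hcm1
    refine gluedRealCode_le_of_mem_uIcc h (by omega) hmem hcm.le ?_
    have := gluedCode_antitone (show 0 < k by omega) (Nat.le_succ m) hm1
    simp only [Nat.succ_eq_add_one] at this
    omega
  -- In the central interval the neighbour `m + 1` is on the other side and gives no bound. But the
  -- image of `t` is right of the fixed point and at most the image of `m`, which is enough.
  · rw [← hcm]
    have hmc : (m : ℝ) + (p * k : ℕ) + 1 = (q * k : ℕ) := by
      have : m + p * k + 1 = q * k := by omega
      exact_mod_cast this
    have hv : gluedValue (p * k) (q * k) k (m + 1) ≤ gluedValue (p * k) (q * k) k m := by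
      rw [gluedValue, if_neg (by omega), gluedValue]
      split_ifs <;> omega
    refine gluedRealCode_le_right h (by omega) ?_ ?_
    · rw [Set.uIcc_of_ge (by exact_mod_cast hv)] at hmem
      exact hmem.2
    · rw [linearMap_gluedPattern_middle hp h hk ⟨by linarith [hm.1], by linarith [hm.2]⟩]
      nlinarith

theorem gluedRealCode_linearMap_le_right (hp : 0 < p) (h : 2 * p < q) (hk : 1 < k) {t : ℝ}
    (ht : t ≤ ((q * k : ℕ) : ℝ) - 1) (hta : gluedFixedPoint p q k < t) :
    gluedRealCode p q k (linearMap (gluedPattern p q k h hk) t) ≤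
      gluedRealCode p q k t - p + q := by
  have hA : k ≤ p * k := copies_le_mul hp
  have hN : 2 * (p * k) + k ≤ q * k := two_mul_add_le_mul h
  have hN' := cast_two_mul_add_le_mul (k := k) h
  have hk0 : (0 : ℝ) < k := by positivity
  have h1 := lt_gluedFixedPoint (k := k) h
  have ht0 : 0 < t := by
    have : (0 : ℝ) ≤ (p * k : ℕ) := Nat.cast_nonneg _
    have : (1 : ℝ) ≤ k := by exact_mod_cast hk.le
    linarith
  obtain ⟨m, hm⟩ : ∃ m, ⌈t⌉₊ = m + 1 := ⟨⌈t⌉₊ - 1, by have := Nat.ceil_pos.2 ht0; omega⟩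
  have hmt : t ∈ Set.Icc (m : ℝ) (m + 1) := by
    have h3 := Nat.le_ceil t
    have h4 := Nat.ceil_lt_add_one ht0.le
    rw [hm] at h3 h4
    push_cast at h3 h4
    exact ⟨by linarith, h3⟩
  have hmN : m + 1 < q * k := by
    have : ⌈t⌉₊ ≤ q * k - 1 := Nat.ceil_le.2 (by rwa [Nat.cast_sub (by omega), Nat.cast_one])
    omega
  have hmA : q * k ≤ m + 1 + p * k := by
    rw [← gluedFixedPoint_lt_natCast_iff h (by omega)]
    push_cast
    exact hta.trans_le hmt.2
  rw [gluedRealCode, gluedRealCode, if_neg hta.not_gt, ← gluedRealCode, hm]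
  have hcm := gluedCode_gluedValue hp h hk hmN
  rw [if_neg hmA.not_gt] at hcm
  have hmem := linearMap_mem_uIcc (gluedPattern p q k h hk) m hmt
  rw [patternValue_gluedPattern hp h hk (by omega), patternValue_gluedPattern hp h hk hmN] at hmem
  rcases le_or_gt (q * k) (m + p * k) with hm1 | hm1
  · have hcm1 := gluedCode_gluedValue hp h hk (show m < q * k by omega)
    rw [if_neg hm1.not_gt] at hcm1
    refine gluedRealCode_le_of_mem_uIcc h (by omega) hmem ?_ hcm.le
    have := gluedCode_monotone (show 0 < k by omega) (Nat.le_succ m) hm1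
    simp only [Nat.succ_eq_add_one] at this
    omega
  · rw [← hcm]
    have hmc : (m : ℝ) + (p * k : ℕ) + 1 = (q * k : ℕ) := by
      have : m + p * k + 1 = q * k := by omega
      exact_mod_cast this
    have hv : gluedValue (p * k) (q * k) k (m + 1) ≤ gluedValue (p * k) (q * k) k m := by
      rw [gluedValue, if_neg (by omega), gluedValue]
      split_ifs <;> omega
    refine gluedRealCode_le_left h (by omega) ?_ (linearMap_gluedPattern_lt hp h hk ht hta)
    rw [Set.uIcc_of_ge (by exact_mod_cast hv)] at hmem
    exact hmem.1

/-- Summed over a cycle the code differences cancel, leaving `n * p ≤ q * R` with `R` the number of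
points on the right. -/
theorem le_overRotationNumber_of_exhibits (hp : 0 < p) (h : 2 * p < q) (hk : 1 < k) {n : ℕ}
    {π : Fin n → Fin n} (hn : 2 ≤ n) (hπ : IsCyclicPattern π)
    (hex : Exhibits (linearMap (gluedPattern p q k h hk)) 0 (((q * k : ℕ) : ℝ) - 1) π) :
    (p : ℝ) / q ≤ overRotationNumber π := by
  obtain ⟨x, hx, hxm, hfx⟩ := hex
  have hfix := linearMap_gluedFixedPoint hp h hk
  have hne := hπ.exhibited_ne_fixedPoint hfix hn hx hfx
  have hsc := signChanges_of_exhibited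
    (fun t ht hta => lt_linearMap_gluedPattern hp h hk ht.1 hta)
    (fun t ht hta => linearMap_gluedPattern_lt hp h hk ht.2 hta) hfix hn hπ hx hxm hfx
  set R := (Finset.univ.filter fun i => gluedFixedPoint p q k < x i).card with hR
  have hle : ∀ i, gluedRealCode p q k (x (π i)) ≤ gluedRealCode p q k (x i) - p +
      q * (if gluedFixedPoint p q k < x i then 1 else 0) := by
    intro i
    rw [← hfx]
    rcases lt_or_gt_of_ne (hne i) with hi | hi
    · rw [if_neg hi.not_gt, mul_zero, add_zero]
      exact gluedRealCode_linearMap_le_left hp h hk (hxm i).1 hi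
    · rw [if_pos hi, mul_one]
      exact gluedRealCode_linearMap_le_right hp h hk (hxm i).2 hi
  have hsum := Finset.sum_le_sum fun i (_ : i ∈ Finset.univ) => hle i
  rw [Finset.sum_add_distrib, Finset.sum_sub_distrib, ← Finset.mul_sum, Finset.sum_boole, ← hR,
    hπ.bijective.sum_comp fun i => gluedRealCode p q k (x i)] at hsum
  simp only [Finset.sum_const, Finset.card_univ, Fintype.card_fin, nsmul_eq_mul] at hsum
  have hnat : n * p ≤ q * R := by
    have : (n : ℤ) * p ≤ q * (R : ℤ) := by linarith
    exact_mod_cast this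
  have hreal : (n : ℝ) * p ≤ q * R := by exact_mod_cast hnat
  have hq : (0 : ℝ) < q := by have : 0 < q := by omega
                              positivity
  have hn' : (0 : ℝ) < n := by positivity
  rw [overRotationNumber, hsc]
  push_cast
  rw [mul_div_mul_left _ _ two_ne_zero, div_le_div_iff₀ hq hn']
  linarith

end

/-! ## Density of the over-rotation numbers -/

open Filter Topology in
-- Weights `1 - 2 t` for the loop `(r, M)` and `t M - r` for the loop `(1, 2)` give the ratio `t`
-- exactly. Integer parts of large multiples approximate these weights, and the fixed connecting
-- cost `(d, c)` vanishes in the limit.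
theorem mem_closure_of_combinations {S : Set ℝ} {M r c d : ℕ} (hM : 2 * r < M)
    (hS : ∀ m l : ℕ, ((m * r + l + d : ℕ) : ℝ) / (m * M + 2 * l + c : ℕ) ∈ S) {t : ℝ}
    (ht : t ∈ Set.Icc ((r : ℝ) / M) (1 / 2)) : t ∈ closure S := by
  have hM0 : (0 : ℝ) < M := by have : 0 < M := by omega
                               positivity
  have hM' : (2 : ℝ) * r < M := by exact_mod_cast hM
  have hα : 0 ≤ 1 - 2 * t := by linarith [ht.2]
  have hβ : 0 ≤ t * M - r := by have := (div_le_iff₀ hM0).1 ht.1; linarith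
  have hfl : ∀ a : ℝ, 0 ≤ a → Tendsto (fun n : ℕ => (⌊a * (n : ℝ)⌋₊ : ℝ) / n) atTop (𝓝 a) :=
    fun a ha => (tendsto_nat_floor_mul_div_atTop ha).comp tendsto_natCast_atTop_atTop
  have hconst : ∀ e : ℕ, Tendsto (fun n : ℕ => (e : ℝ) / n) atTop (𝓝 0) :=
    fun e => tendsto_const_div_atTop_nhds_zero_nat _
  have hnum := (((hfl _ hα).mul_const (r : ℝ)).add (hfl _ hβ)).add (hconst d)
  have hden := (((hfl _ hα).mul_const (M : ℝ)).add ((hfl _ hβ).const_mul 2)).add (hconst c)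
  have hlim := hnum.div hden (by nlinarith)
  have hval : ((1 - 2 * t) * r + (t * M - r) + 0) / ((1 - 2 * t) * M + 2 * (t * M - r) + 0) = t := by
    rw [div_eq_iff (by nlinarith)]
    ring
  rw [hval] at hlim
  refine mem_closure_of_tendsto hlim ?_
  filter_upwards [eventually_gt_atTop 0] with n hn
  convert hS ⌊(1 - 2 * t) * (n : ℝ)⌋₊ ⌊(t * M - r) * (n : ℝ)⌋₊ using 1
  have hn' : (n : ℝ) ≠ 0 := by positivity
  simp only [Pi.div_apply]
  push_cast
  rw [← mul_div_mul_right _ _ hn']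
  congr 1 <;> field_simp

section

variable {p q k : ℕ}

/-- If the sides always agreed, the code difference would be constant in time. Writing `v` as the
`d`-th iterate of `u`, the codes along every `d`-th iterate would form an infinite arithmetic
progression on a finite cycle. -/
theorem exists_separating_iterate (hp : 0 < p) (hpq : Nat.Coprime p q) (h : 2 * p < q)
    (hk : 1 < k) {u v : Fin (q * k)}
    (huv : gluedCode p q k u ≠ gluedCode p q k v) :
    ∃ i, ¬ (((gluedPattern p q k h hk)^[i] u : ℕ) + p * k < q * k ↔
      ((gluedPattern p q k h hk)^[i] v : ℕ) + p * k < q * k) := by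
  by_contra! hall
  set π := gluedPattern p q k h hk with hπ
  have hdiff : ∀ i, gluedCode p q k (π^[i] v) - gluedCode p q k (π^[i] u) =
      gluedCode p q k v - gluedCode p q k u := by
    intro i
    induction i with
    | zero => rfl
    | succ i ih =>
      have := hall i
      rw [Function.iterate_succ_apply', Function.iterate_succ_apply', gluedPattern_val hp,
        gluedPattern_val hp, gluedCode_gluedValue hp h hk (Fin.is_lt _),
        gluedCode_gluedValue hp h hk (Fin.is_lt _), ← ih]
      simp only [this]
      ring
  obtain ⟨d, rfl⟩ := gluedPattern_isCyclicPattern hp hpq h hk u v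
  have hlin : ∀ n : ℕ, gluedCode p q k (π^[n * d] u) =
      gluedCode p q k u + n * (gluedCode p q k (π^[d] u) - gluedCode p q k u) := by
    intro n
    induction n with
    | zero => simp
    | succ n ih =>
      have := hdiff (n * d)
      rw [← Function.iterate_add_apply, ← Nat.succ_mul] at this
      simp only [Nat.succ_eq_add_one] at this
      push_cast
      linarith
  obtain ⟨m, n, hmn, heq⟩ := Finite.exists_ne_map_eq_of_infinite fun n : ℕ => π^[n * d] u
  have h1 := hlin m
  have h2 := hlin n
  rw [show π^[m * d] u = π^[n * d] u from heq, h2] at h1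
  have h3 := mul_right_cancel₀ (sub_ne_zero.2 huv.symm) (add_left_cancel h1)
  exact hmn (by exact_mod_cast h3.symm)

/-! ### Paths of coverings between the `γ`-loop and the central loop -/

theorem subset_left_of_lt (h : 2 * p < q) (hk : 0 < k) {m n : ℕ} (hm : m + p * k < q * k)
    (hn : n + p * k < q * k) :
    Set.uIcc (m : ℝ) n ⊆ Set.Icc 0 (gluedFixedPoint p q k) :=
  Set.uIcc_subset_Icc ⟨Nat.cast_nonneg m, ((natCast_lt_gluedFixedPoint_iff h hk m).2 hm).le⟩
    ⟨Nat.cast_nonneg n, ((natCast_lt_gluedFixedPoint_iff h hk n).2 hn).le⟩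

theorem subset_right_of_le (h : 2 * p < q) (hk : 0 < k) {m n : Fin (q * k)}
    (hm : q * k ≤ (m : ℕ) + p * k) (hn : q * k ≤ (n : ℕ) + p * k) :
    Set.uIcc ((m : ℕ) : ℝ) (n : ℕ) ⊆
      Set.Icc (gluedFixedPoint p q k) (((q * k : ℕ) : ℝ) - 1) := by
  have hle : ∀ i : Fin (q * k), ((i : ℕ) : ℝ) ≤ ((q * k : ℕ) : ℝ) - 1 := by
    intro i
    have : ((i : ℕ) : ℝ) + 1 ≤ (q * k : ℕ) := by exact_mod_cast i.2
    linarith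
  exact Set.uIcc_subset_Icc ⟨((gluedFixedPoint_lt_natCast_iff h hk m).2 hm).le, hle m⟩
    ⟨((gluedFixedPoint_lt_natCast_iff h hk n).2 hn).le, hle n⟩

theorem gluedFixedPoint_mem_Icc (hp : 0 < p) (h : 2 * p < q) (hk : 1 < k) :
    gluedFixedPoint p q k ∈ Set.Icc (0 : ℝ) (((q * k : ℕ) : ℝ) - 1) := by
  have hA : k ≤ p * k := copies_le_mul hp
  have hN : 2 * (p * k) + k ≤ q * k := two_mul_add_le_mul h
  have h1 := (natCast_lt_gluedFixedPoint_iff h (by omega) 0).2 (show 0 + p * k < q * k by omega)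
  have h2 := (gluedFixedPoint_lt_natCast_iff h (by omega) (q * k - 1)).2
    (show q * k ≤ q * k - 1 + p * k by omega)
  rw [Nat.cast_sub (by omega), Nat.cast_one] at h2
  rw [Nat.cast_zero] at h1
  exact ⟨h1.le, h2.le⟩

/-- The interval spanned by the `j`-th points of the first two copies. -/
noncomputable def copyPair (h : 2 * p < q) (hk : 1 < k) (j : Fin q) : ℝ × ℝ :=
  (((spatialPosition p q k h (j, ⟨0, by omega⟩) : ℕ) : ℝ),
    ((spatialPosition p q k h (j, ⟨1, hk⟩) : ℕ) : ℝ))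

theorem spatialPosition_add_lt_iff (hp : 0 < p) (h : 2 * p < q) (j : Fin q) (i : Fin k) :
    (spatialPosition p q k h (j, i) : ℕ) + p * k < q * k ↔ (j : ℕ) + p < q := by
  have hi := i.2
  rw [spatialPosition_val hp]
  constructor
  · intro hlt
    by_contra! hge
    have := Nat.mul_le_mul_right k hge
    rw [Nat.add_mul] at this
    split_ifs at hlt <;> omega
  · intro hlt
    have : ((j : ℕ) + p + 1) * k ≤ q * k := Nat.mul_le_mul_right k hlt
    rw [Nat.add_mul, Nat.add_mul] at this
    rw [if_pos hlt]
    omega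

/-- The code does the counting of right visits: for a closed path its terms cancel and `q * r = p *
m` remains. -/
theorem coverPath_copyPair (hp : 0 < p) (h : 2 * p < q) (hk : 1 < k) (m : ℕ) :
    ∀ j : Fin q, ∃ r : ℕ,
      CoverPath (linearMap (gluedPattern p q k h hk)) 0 (((q * k : ℕ) : ℝ) - 1)
        (gluedFixedPoint p q k) (copyPair h hk j)
        (copyPair h hk ((gammaPattern p q h)^[m] j)) m r ∧
      (q : ℤ) * r = p * m + gammaCode p q ((gammaPattern p q h)^[m] j) - gammaCode p q j := by
  have ha := gluedFixedPoint_mem_Icc hp h hk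
  have hx : StrictMono fun i : Fin (q * k) => ((i : ℕ) : ℝ) :=
    fun i j hij => Nat.cast_lt.2 hij
  have hcov : ∀ j, Covers (linearMap (gluedPattern p q k h hk)) (copyPair h hk j)
      (copyPair h hk (gammaPattern p q h j)) := covers_of_exhibited hp h hk hx
        fun i => linearMap_natCast _ i
  have hside : ∀ j : Fin q, ((j : ℕ) + p < q → Set.uIcc (copyPair h hk j).1 (copyPair h hk j).2 ⊆
      Set.Icc 0 (gluedFixedPoint p q k)) ∧
      (¬ (j : ℕ) + p < q → Set.uIcc (copyPair h hk j).1 (copyPair h hk j).2 ⊆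
        Set.Icc (gluedFixedPoint p q k) (((q * k : ℕ) : ℝ) - 1)) := by
    refine fun j => ⟨fun hj => ?_, fun hj => ?_⟩
    · rw [← spatialPosition_add_lt_iff (k := k) hp h j ⟨0, by omega⟩] at hj
      have hj' := hj
      rw [spatialPosition_add_lt_iff hp, ← spatialPosition_add_lt_iff (k := k) hp h j ⟨1, hk⟩] at hj'
      exact subset_left_of_lt h (by omega) hj hj'
    · rw [← spatialPosition_add_lt_iff (k := k) hp h j ⟨0, by omega⟩] at hj
      have hj' := hj
      rw [spatialPosition_add_lt_iff hp, ← spatialPosition_add_lt_iff (k := k) hp h j ⟨1, hk⟩] at hj'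
      exact subset_right_of_le h (by omega) (not_lt.1 hj) (not_lt.1 hj')
  induction m with
  | zero =>
    intro j
    refine ⟨0, .refl _ ?_, by simp⟩
    by_cases hj : (j : ℕ) + p < q
    · exact ((hside j).1 hj).trans (Set.Icc_subset_Icc_right ha.2)
    · exact ((hside j).2 hj).trans (Set.Icc_subset_Icc_left ha.1)
  | succ m ih =>
    intro j
    obtain ⟨r, hr, hrc⟩ := ih (gammaPattern p q h j)
    rw [gammaCode_gammaPattern] at hrc
    rw [Function.iterate_succ_apply]
    by_cases hj : (j : ℕ) + p < q
    · rw [if_pos hj] at hrc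
      refine ⟨r, .left ((hside j).1 hj) ha.2 (hcov j) hr, ?_⟩
      push_cast
      linarith
    · rw [if_neg hj] at hrc
      refine ⟨r + 1, .right ((hside j).2 hj) ha.1 (hcov j) hr, ?_⟩
      push_cast
      linarith

/-- The part of the basic interval around the fixed point to the left of that point. -/
noncomputable def leftCentral (p q k : ℕ) : ℝ × ℝ :=
  (((q * k : ℕ) : ℝ) - (p * k : ℕ) - 1, gluedFixedPoint p q k)

/-- The part of the basic interval around the fixed point to the right of that point. -/
noncomputable def rightCentral (p q k : ℕ) : ℝ × ℝ :=
  (gluedFixedPoint p q k, ((q * k : ℕ) : ℝ) - (p * k : ℕ))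

theorem leftCentral_subset_of_separated (h : 2 * p < q) (hk : 0 < k) {m n : ℕ}
    (hm : m + p * k < q * k) (hn : q * k ≤ n + p * k) :
    Set.uIcc (leftCentral p q k).1 (leftCentral p q k).2 ⊆ Set.uIcc (m : ℝ) n := by
  have h1 := lt_gluedFixedPoint (k := k) h
  have h2 := (gluedFixedPoint_lt_natCast_iff h hk n).2 hn
  have h3 : (m : ℝ) + (p * k : ℕ) + 1 ≤ (q * k : ℕ) := by exact_mod_cast hm
  apply Set.uIcc_subset_uIcc <;> rw [Set.mem_uIcc] <;> left <;> simp only [leftCentral] <;>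
    constructor <;> linarith

/-- Until the ends separate, the interval spanned by the two orbits lies on one side. At the first
separation, time `i + 1`, it spans the fixed point, hence contains the left half of the central
interval. -/
theorem coverPath_separated (hp : 0 < p) (h : 2 * p < q) (hk : 1 < k) (i : ℕ) :
    ∀ u v : Fin (q * k),
      (∀ t ≤ i, (((gluedPattern p q k h hk)^[t] u : ℕ) + p * k < q * k ↔
        ((gluedPattern p q k h hk)^[t] v : ℕ) + p * k < q * k)) →
      ¬ (((gluedPattern p q k h hk)^[i + 1] u : ℕ) + p * k < q * k ↔
        ((gluedPattern p q k h hk)^[i + 1] v : ℕ) + p * k < q * k) →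
      (Set.uIcc (leftCentral p q k).1 (leftCentral p q k).2 ⊆
        Set.Icc 0 (((q * k : ℕ) : ℝ) - 1)) →
      ∃ r, CoverPath (linearMap (gluedPattern p q k h hk)) 0 (((q * k : ℕ) : ℝ) - 1)
        (gluedFixedPoint p q k) (((u : ℕ) : ℝ), ((v : ℕ) : ℝ)) (leftCentral p q k) (i + 1) r := by
  have ha := gluedFixedPoint_mem_Icc hp h hk
  have hone : ∀ (u v : Fin (q * k)) (K : ℝ × ℝ) (n r : ℕ),
      ((u : ℕ) + p * k < q * k ↔ (v : ℕ) + p * k < q * k) → ∀ J : ℝ × ℝ,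
      Set.uIcc J.1 J.2 ⊆ Set.uIcc ((gluedPattern p q k h hk u : ℕ) : ℝ)
        (gluedPattern p q k h hk v : ℕ) →
      CoverPath (linearMap (gluedPattern p q k h hk)) 0 (((q * k : ℕ) : ℝ) - 1)
        (gluedFixedPoint p q k) J K n r →
      ∃ r', CoverPath (linearMap (gluedPattern p q k h hk)) 0 (((q * k : ℕ) : ℝ) - 1)
        (gluedFixedPoint p q k) (((u : ℕ) : ℝ), ((v : ℕ) : ℝ)) K (n + 1) r' := by
    intro u v K n r huv J hJ hJK
    have hcov : Covers (linearMap (gluedPattern p q k h hk)) (((u : ℕ) : ℝ), ((v : ℕ) : ℝ)) J := by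
      rwa [Covers, linearMap_natCast, linearMap_natCast]
    by_cases hu : (u : ℕ) + p * k < q * k
    · exact ⟨_, .left (subset_left_of_lt h (by omega) hu (huv.1 hu)) ha.2 hcov hJK⟩
    · exact ⟨_, .right (subset_right_of_le h (by omega) (not_lt.1 hu)
        (not_lt.1 fun hv => hu (huv.2 hv))) ha.1 hcov hJK⟩
  induction i with
  | zero =>
    intro u v hsame hsep hsub
    refine hone u v _ 0 0 (hsame 0 le_rfl) (leftCentral p q k) ?_ (.refl _ hsub)
    simp only [zero_add, Function.iterate_one] at hsep
    by_cases hu : (gluedPattern p q k h hk u : ℕ) + p * k < q * k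
    · exact leftCentral_subset_of_separated h (by omega) hu (by
        by_contra! hv
        exact hsep (by simp only [hu, hv]))
    · rw [Set.uIcc_comm ((gluedPattern p q k h hk u : ℕ) : ℝ)]
      refine leftCentral_subset_of_separated h (by omega) ?_ (not_lt.1 hu)
      by_contra hv
      exact hsep (by simp only [hu, hv])
  | succ i ih =>
    intro u v hsame hsep hsub
    obtain ⟨r, hr⟩ := ih (gluedPattern p q k h hk u) (gluedPattern p q k h hk v)
      (fun t ht => hsame (t + 1) (by omega)) hsep hsub
    exact hone u v _ _ r (hsame 0 (by omega)) _ subset_rfl hr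

theorem forcedInterval_gluedPattern (hp : 0 < p) (hpq : Nat.Coprime p q) (h : 2 * p < q)
    (hk : 1 < k) :
    forcedInterval (gluedPattern p q k h hk) = Set.Icc ((p : ℝ) / (q : ℝ)) (1 / 2) := by
  have hA : k ≤ p * k := copies_le_mul hp
  have hN : 2 * (p * k) + k ≤ q * k := two_mul_add_le_mul h
  have hN' := cast_two_mul_add_le_mul (k := k) h
  have hA' : (k : ℝ) ≤ (p * k : ℕ) := by exact_mod_cast hA
  have hk' : (2 : ℝ) ≤ k := by exact_mod_cast hk
  apply Set.Subset.antisymm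
  · refine closure_minimal ?_ isClosed_Icc
    rintro _ ⟨n, π, hn, hπ, hex, rfl⟩
    exact ⟨le_overRotationNumber_of_exhibits hp h hk hn hπ hex, overRotationNumber_le_half π⟩
  set f := linearMap (gluedPattern p q k h hk) with hf
  set a := gluedFixedPoint p q k with hadef
  set hi := ((q * k : ℕ) : ℝ) - 1 with hhi
  have ha := gluedFixedPoint_mem_Icc hp h hk
  have ha1 := lt_gluedFixedPoint (k := k) h
  have ha2 := gluedFixedPoint_lt h (show 0 < k by omega)
  rw [← hadef] at ha1 ha2
  have hint : IsIntervalMap f 0 hi := isIntervalMap_linearMap _ (by omega)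
  have hfix : f a = a := linearMap_gluedFixedPoint hp h hk
  have hfl : f (((q * k : ℕ) : ℝ) - (p * k : ℕ) - 1) = ((q * k : ℕ) : ℝ) - (p * k : ℕ) := by
    rw [hf, linearMap_gluedPattern_middle hp h hk ⟨le_rfl, by linarith⟩, gluedFixedPoint]
    generalize ((q * k : ℕ) : ℝ) = N at *
    generalize ((p * k : ℕ) : ℝ) = A at *
    have e : 1 / (N - 2 * A + 1) * (N - 2 * A + 1) = 1 := one_div_mul_cancel (by linarith)
    linear_combination e
  have hfr : f (((q * k : ℕ) : ℝ) - (p * k : ℕ)) = (p * k : ℕ) := by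
    rw [hf, linearMap_gluedPattern_middle hp h hk ⟨by linarith, le_rfl⟩, gluedFixedPoint]
    generalize ((q * k : ℕ) : ℝ) = N at *
    generalize ((p * k : ℕ) : ℝ) = A at *
    have e : 1 / (N - 2 * A + 1) * (N - 2 * A + 1) = 1 := one_div_mul_cancel (by linarith)
    linear_combination e
  have hU : Set.uIcc (leftCentral p q k).1 (leftCentral p q k).2 ⊆ Set.Icc 0 a :=
    Set.uIcc_subset_Icc ⟨by simp only [leftCentral]; linarith, ha1.le⟩ ⟨ha.1, le_rfl⟩
  have hV : Set.uIcc (rightCentral p q k).1 (rightCentral p q k).2 ⊆ Set.Icc a hi :=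
    Set.uIcc_subset_Icc ⟨le_rfl, ha.2⟩ ⟨ha2.le, by simp only [rightCentral]; linarith⟩
  have hUV : Covers f (leftCentral p q k) (rightCentral p q k) := by
    simp only [Covers, leftCentral, rightCentral, ← hadef, hfl, hfix]
    rw [Set.uIcc_comm]
  have hcentral : ∀ J, Set.uIcc J.1 J.2 ⊆ Set.Icc ((p * k : ℕ) : ℝ) a →
      Covers f (rightCentral p q k) J := by
    intro J hJ
    simp only [Covers, rightCentral, ← hadef, hfr, hfix]
    rwa [Set.uIcc_of_ge (show ((p * k : ℕ) : ℝ) ≤ a by linarith)]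
  have hVU : Covers f (rightCentral p q k) (leftCentral p q k) :=
    hcentral _ (Set.uIcc_subset_Icc ⟨by simp only [leftCentral]; linarith, ha1.le⟩
      ⟨by simp only [leftCentral, ← hadef]; linarith, le_rfl⟩)
  have hloop : CoverPath f 0 hi a (leftCentral p q k) (leftCentral p q k) 2 1 :=
    .left hU ha.2 hUV (.right hV ha.1 hVU (.refl _ (hU.trans (Set.Icc_subset_Icc_right ha.2))))
  -- The pair at `o` is `[0, 1]`, from which the `γ`-loop is left; the pair at `o'` is `[A, A + 1]`
  -- with `A = p * k`, where it is re-entered from the central interval. The latter avoids `a` and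
  -- serves as base of the loops.
  set o : Fin q := ⟨0, by omega⟩ with ho
  set o' := gammaPattern p q h o with ho'
  have ho'v : (o' : ℕ) = p := by
    rw [ho', gammaPattern_val, if_pos (by simp [ho]; omega)]; simp [ho]
  have hpair' : copyPair h hk o' = (((p * k : ℕ) : ℝ), ((p * k + 1 : ℕ) : ℝ)) := by
    rw [copyPair, spatialPosition_val hp, spatialPosition_val hp, ho'v, if_pos (by omega),
      if_pos (by omega), add_zero]
  have hpair : copyPair h hk o = ((((⟨0, by omega⟩ : Fin (q * k)) : ℕ) : ℝ),
      (((⟨1, by omega⟩ : Fin (q * k)) : ℕ) : ℝ)) := by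
    rw [copyPair, spatialPosition_val hp, spatialPosition_val hp, if_pos (by simp [ho]; omega),
      if_pos (by simp [ho]; omega)]
    simp [ho]
  have hlt1 : ((p * k + 1 : ℕ) : ℝ) < a :=
    (natCast_lt_gluedFixedPoint_iff h (by omega) _).2 (by omega)
  have hlt0 : ((p * k : ℕ) : ℝ) < a :=
    (natCast_lt_gluedFixedPoint_iff h (by omega) _).2 (by omega)
  have hVpair : Covers f (rightCentral p q k) (copyPair h hk o') := by
    refine hcentral _ ?_
    rw [hpair']
    exact Set.uIcc_subset_Icc ⟨le_rfl, hlt0.le⟩ ⟨by push_cast; linarith, hlt1.le⟩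
  obtain ⟨m₀, hm₀⟩ := gammaPattern_isCyclicPattern hpq h o' o
  obtain ⟨r₀, hpath₀, -⟩ := coverPath_copyPair hp h hk m₀ o'
  obtain ⟨r, hpath, hr⟩ := coverPath_copyPair hp h hk (m₀ + 1) o'
  rw [hm₀] at hpath₀
  rw [Function.iterate_succ_apply', hm₀, ← ho'] at hpath hr
  set M := m₀ + 1 with hM
  have hrM : q * r = p * M := by
    have : (q : ℤ) * r = p * M := by linarith
    exact_mod_cast this
  have hexits : ∃ i r₁, CoverPath f 0 hi a (copyPair h hk o) (leftCentral p q k) (i + 1) r₁ := by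
    classical
    -- The codes at 0 and 1 are `0` and `-1`.
    have hne : gluedCode p q k (⟨0, by omega⟩ : Fin (q * k)) ≠
        gluedCode p q k (⟨1, by omega⟩ : Fin (q * k)) := by
      simp only [gluedCode]
      rw [if_pos (by omega), if_pos (by omega)]
      have e : (-((1 : ℕ) : ℤ)) = (k - 1 : ℤ) + (-1) * k := by push_cast; ring
      have e' : ((k : ℤ) - 1) / k = 0 := Int.ediv_eq_zero_of_lt (by omega) (by omega)
      rw [e, Int.add_mul_ediv_right _ _ (by omega), e']
      simp
    have hex := exists_separating_iterate hp hpq h hk hne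
    have hmin := fun t ht => not_not.1 (Nat.find_min hex (m := t) ht)
    have hspec := Nat.find_spec hex
    obtain ⟨i, hi'⟩ : ∃ i, Nat.find hex = i + 1 := by
      refine Nat.exists_eq_succ_of_ne_zero fun h0 => ?_
      rw [h0] at hspec
      apply hspec
      simp only [Function.iterate_zero, id]
      constructor <;> intro <;> omega
    rw [hi'] at hmin hspec
    obtain ⟨r₁, hr₁⟩ := coverPath_separated hp h hk i _ _ (fun t ht => hmin t (by omega)) hspec
      (hU.trans (Set.Icc_subset_Icc_right ha.2))
    exact ⟨i, r₁, hpair ▸ hr₁⟩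
  obtain ⟨i, r₁, hpath₁⟩ := hexits
  have hpath₂ : CoverPath f 0 hi a (leftCentral p q k) (copyPair h hk o') 2 1 :=
    .left hU ha.2 hUV (.right hV ha.1 hVpair (.refl _ hpath.subset_Icc))
  intro t ht
  have hq0 : (0 : ℝ) < q := by have : 0 < q := by omega
                               positivity
  have hM0 : (0 : ℝ) < M := by positivity
  have hclosed : closure (forcedInterval (gluedPattern p q k h hk)) =
      forcedInterval (gluedPattern p q k h hk) := closure_closure
  rw [← hclosed]
  refine mem_closure_of_combinations (M := M) (r := r) (c := m₀ + (i + 1) + 2)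
    (d := r₀ + r₁ + 1) ?_ (fun m l => ?_) ?_
  · have h1 : q * (2 * r) < q * M := by
      calc q * (2 * r) = 2 * (q * r) := by ring
        _ = (2 * p) * M := by rw [hrM]; ring
        _ < q * M := Nat.mul_lt_mul_of_pos_right h (by omega)
    exact Nat.lt_of_mul_lt_mul_left h1
  -- Turn `m` times in the `γ`-loop, go to the pair `[0, 1]` and on to the centre, turn `l` times
  -- there, and return.
  · have htotal := (((hpath.pow m).trans (hpath₀.trans hpath₁)).trans (hloop.pow l)).trans hpath₂
    obtain ⟨x, hx, hper, hxa, hcard⟩ := htotal.exists_periodic hint hfix (by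
      rw [hpair', Set.mem_uIcc]
      rintro (hh | hh) <;> linarith [hh.2])
    have := exists_pattern_of_periodic hint
      (fun t ht hta => lt_linearMap_gluedPattern hp h hk ht.1 hta)
      (fun t ht hta => linearMap_gluedPattern_lt hp h hk ht.2 hta) hfix (by omega) hx hxa hper
    rw [hcard] at this
    rw [show m * r + l + (r₀ + r₁ + 1) = m * r + (r₀ + r₁) + l * 1 + 1 by ring,
      show m * M + 2 * l + (m₀ + (i + 1) + 2) = m * M + (m₀ + (i + 1)) + l * 2 + 2 by ring]
    exact this
  · convert ht using 2
    rw [div_eq_div_iff hM0.ne' hq0.ne']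
    have : (q : ℝ) * r = p * M := by exact_mod_cast hrM
    linarith

/-! ### Conclusion -/

theorem gluedPattern_isVeryBadlyOrdered (hp : 0 < p) (hpq : Nat.Coprime p q) (h : 2 * p < q)
    (hk : 1 < k) : IsVeryBadlyOrdered (gluedPattern p q k h hk) := by
  have hA : k ≤ p * k := copies_le_mul hp
  have hN : 2 * (p * k) + k ≤ q * k := two_mul_add_le_mul h
  refine ⟨by omega, gluedPattern_isCyclicPattern hp hpq h hk, ?_,
    fun m θ hθ _ => not_hasBlockStructureOver_gluedPattern hp hpq h hk hθ⟩
  rw [forcedInterval_gluedPattern hp hpq h hk, overRotationNumber_gluedPattern hp hpq h hk]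
  apply isLeast_Icc
  have hq0 : (0 : ℝ) < q := by have : 0 < q := by omega
                               positivity
  rw [div_le_div_iff₀ hq0 two_pos]
  have : (2 : ℝ) * p ≤ q := by exact_mod_cast h.le
  linarith

theorem gluedPattern_hasOverRotationPair (hp : 0 < p) (hpq : Nat.Coprime p q) (h : 2 * p < q)
    (hk : 1 < k) : HasOverRotationPair (gluedPattern p q k h hk) (k * p) (k * q) :=
  ⟨Nat.mul_comm q k, (signChanges_gluedPattern hp hpq h hk).symm⟩

end

theorem mainTheorem6 :
    (∀ (p q k : ℕ) (_hp : 0 < p) (_hpq : Nat.Coprime p q) (h : 2 * p < q) (hk : 1 < k),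
      IsCyclicPattern (gluedPattern p q k h hk) ∧
      IsUnimodalPattern (gluedPattern p q k h hk) ∧
      HasOverRotationPair (gluedPattern p q k h hk) (k * p) (k * q) ∧
      forcedInterval (gluedPattern p q k h hk) = Set.Icc ((p : ℝ) / (q : ℝ)) (1 / 2) ∧
      (∀ (m : ℕ) (θ : Fin m → Fin m), IsOverTwist θ →
        ¬ HasBlockStructureOver (gluedPattern p q k h hk) θ) ∧
      IsVeryBadlyOrdered (gluedPattern p q k h hk)) ∧
    (∀ r s : ℕ, 0 < r → 2 * r < s → ¬ Nat.Coprime r s →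
      ∃ (n : ℕ) (π : Fin n → Fin n), IsCyclicPattern π ∧ IsUnimodalPattern π ∧
        HasOverRotationPair π r s ∧ IsVeryBadlyOrdered π) := by
  refine ⟨fun p q k hp hpq h hk => ⟨gluedPattern_isCyclicPattern hp hpq h hk,
    gluedPattern_isUnimodalPattern hp h hk, gluedPattern_hasOverRotationPair hp hpq h hk,
    forcedInterval_gluedPattern hp hpq h hk,
    fun m θ hθ => not_hasBlockStructureOver_gluedPattern hp hpq h hk hθ,
    gluedPattern_isVeryBadlyOrdered hp hpq h hk⟩, fun r s hr hrs hcop => ?_⟩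
  -- The number of copies is the greatest common divisor of `r` and `s`, which exceeds 1 exactly
  -- because they are not coprime.
  obtain ⟨p, q, hpq, hp, hq⟩ := Nat.exists_coprime r s
  have hg0 : 0 < Nat.gcd r s := Nat.gcd_pos_of_pos_left _ hr
  have hg1 : Nat.gcd r s ≠ 1 := hcop
  generalize Nat.gcd r s = k at *
  subst hp hq
  have hp0 : 0 < p := Nat.pos_of_mul_pos_right hr
  have h : 2 * p < q := Nat.lt_of_mul_lt_mul_right (a := k) (by linarith)
  have hk : 1 < k := by omega
  refine ⟨_, gluedPattern p q k h hk, gluedPattern_isCyclicPattern hp0 hpq h hk,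
    gluedPattern_isUnimodalPattern hp0 h hk, ?_, gluedPattern_isVeryBadlyOrdered hp0 hpq h hk⟩
  have := gluedPattern_hasOverRotationPair hp0 hpq h hk
  rwa [Nat.mul_comm k p, Nat.mul_comm k q] at this
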